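/- Let $H_n=\mathbb C^n\times\mathbb R$ be the Heisenberg group with coordinates $(z,t)$, $z_\beta=x_\beta+iy_\beta$, contact form $\Theta=dt+\sum_\beta(x_\beta dy_\beta-y_\beta dx_\beta)$, contact bundle $\xi=\ker\Theta$, CR structure $J(\partial_{x_\beta}+y_\beta\partial_t)=\partial_{y_\beta}-x_\beta\partial_t$, $J^2=-1$ on $\xi$, and $T=\partial_t$. A pseudohermitian transformation between pseudohermitian manifolds is a diffeomorphism that preserves the contact forms and intertwines the CR structures on the contact bundles; the Heisenberg rigid motions are the pseudohermitian transformations of $H_n$ onto itself. A pseudohermitian submanifold of $H_n$ of CR dimension $m\ge 1$ is a pseudohermitian manifold $(M^{2m+1},\hat J,\hat\theta)$ immersed in $H_n$ such that $\hat\theta=\Theta|_M$ (so $\hat\xi=\ker\hat\theta=TM\cap\xi$) and $\hat J=J|_{\hat\xi}$. Its fundamental vector field is the horizontal field $\nu\perp\hat\xi$ with $T+\nu\in TM$; $M$ is vertical if $\nu\equiv0$. For a local unitary frame $Z_1,\dots,Z_n$ of $T_{1,0}H_n$ along $M$ with $Z_1,\dots,Z_m$ tangent to $M$ and $Z_{m+1},\dots,Z_n$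 normal (a Darboux frame), $\theta^\beta$ is the dual coframe and $\theta_\beta{}^\gamma$ are the connection forms of the (flat) pseudohermitian connection of $H_n$, restricted to $M$; the second fundamental form is $II=\sum\theta^j\otimes\theta_j{}^a\otimes Z_a$ (sum over $j\le m<a\le n$), and the normal connection is $\nabla^\perp Z_a=\sum_b\theta_a{}^b\otimes Z_b$. A point is flat if $II=0$ there. Let $m=n-1\ge1$, and let $M$ and $N$ be two simply connected vertical pseudohermitian submanifolds of $H_n$ of CR dimension $n-1$ without flat points, with immersions $\iota_M,\iota_N$. Then: (1) A diffeomorphism $\varphi:M\to N$ is a pseudohermitian transformation if and only if it is the restriction of a Heisenberg rigid motion, i.e. $\iota_N\circ\varphi=\Phi\circ\iota_M$ for some Heisenberg rigid motion $\Phi$. So the induced pseudohermitian structure is a complete invariant. (2) For every Darboux frame over an open $U\subset M$, the Tanaka-Webster connection forms $\hat\theta_j{}^k$ of $(Z_1,\dots,Z_m)$ exist on $U$, and, with $h_{jk}=II(Z_j,Z_k)$ (the coefficient of $Z_n$) and with $R_{j\bar lp\bar q}$ the Webster curvature of $(M,\hat J,\hat\theta)$, one has $h_{jk}=h_{kj}$,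 $\theta_j{}^n=\sum_kh_{jk}\theta^k$, the Gauss-like equation $$R_{j\bar lp\bar q}=-h_{jp}\,\overline{h_{lq}}$$ and the Codazzi-like equation $$d\theta_j{}^n=\sum_k\hat\theta_j{}^k\wedge\theta_k{}^n+\theta_j{}^n\wedge\theta_n{}^n .$$ At each point of $U$ the Gauss-like equation determines $(h_{jk})$ up to a common factor of modulus one (the choice of the unit normal $Z_n$), and, given $(\theta_j{}^n)$, the form $\theta_n{}^n$ of the normal connection is the only purely imaginary one-form that satisfies the Codazzi-like equation. (3) Consequently $II$ and $\nabla^\perp$ are determined by the induced structure: if $\varphi:M\to N$ is a pseudohermitian transformation, then every Darboux frame $(Z_j,Z_n)$ over an open $U\subset M$ has a counterpart $(\tilde Z_j,\tilde Z_n)$ over $\varphi(U)$ with $\tilde Z_j=\varphi_*Z_j$, $\tilde h_{jk}\circ\varphi=h_{jk}$ and $\varphi^*\tilde\theta_n{}^n=\theta_n{}^n$. -/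

import Mathlib

open scoped Manifold ContDiff

noncomputable section

namespace Pseudohermitian

/-! ### One-forms on a manifold modelled on a real normed space -/

section Forms

variable {E : Type*} [NormedAddCommGroup E] [NormedSpace ℝ E]
  {M : Type*} [TopologicalSpace M] [ChartedSpace E M]
  {F : Type*} [NormedAddCommGroup F] [NormedSpace ℝ F]

/-- The pullback of the `F`-valued one-form `κ` by the inverse of the chart around `x₀`. -/
def formInChart (κ : ∀ x : M, TangentSpace 𝓘(ℝ, E) x →L[ℝ] F) (x₀ : M) (y : E) : E →L[ℝ] F :=
  (κ ((extChartAt 𝓘(ℝ, E) x₀).symm y)).comp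
    (mfderiv 𝓘(ℝ, E) 𝓘(ℝ, E) (extChartAt 𝓘(ℝ, E) x₀).symm y)

/-- The one-form `κ` is smooth on `U`: its expressions in charts are smooth. -/
def SmoothFormOn (κ : ∀ x : M, TangentSpace 𝓘(ℝ, E) x →L[ℝ] F) (U : Set M) : Prop :=
  ∀ x₀ : M, ContDiffOn ℝ ∞ (formInChart κ x₀)
    ((extChartAt 𝓘(ℝ, E) x₀).target ∩ (extChartAt 𝓘(ℝ, E) x₀).symm ⁻¹' U)

/-- The value `dκ (v, w)` at `x` of the exterior derivative of the one-form `κ`, with the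
convention `dκ (X, Y) = X (κ Y) - Y (κ X) - κ [X, Y]`. It is computed in the chart around `x`,
through which Mathlib identifies the tangent space at `x` with the model space. -/
def extD (κ : ∀ x : M, TangentSpace 𝓘(ℝ, E) x →L[ℝ] F) (x : M)
    (v w : TangentSpace 𝓘(ℝ, E) x) : F :=
  let D : E →L[ℝ] E →L[ℝ] F := fderiv ℝ (formInChart κ x) (extChartAt 𝓘(ℝ, E) x x)
  D v w - D w v

/-- The expression in the chart around `x₀` of a field of endomorphisms of the tangent bundle. -/
def endoInChart (J : ∀ x : M, TangentSpace 𝓘(ℝ, E) x →L[ℝ] TangentSpace 𝓘(ℝ, E) x) (x₀ : M)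
    (y : E) : E →L[ℝ] E :=
  ((mfderiv 𝓘(ℝ, E) 𝓘(ℝ, E) (extChartAt 𝓘(ℝ, E) x₀)
      ((extChartAt 𝓘(ℝ, E) x₀).symm y)).comp (J ((extChartAt 𝓘(ℝ, E) x₀).symm y))).comp
    (mfderiv 𝓘(ℝ, E) 𝓘(ℝ, E) (extChartAt 𝓘(ℝ, E) x₀).symm y)

/-- `(α ∧ β) (v, w)` for complex-valued real-linear forms. -/
def wedge {V : Type*} [AddCommGroup V] [Module ℝ V] [TopologicalSpace V]
    (α β : V →L[ℝ] ℂ) (v w : V) : ℂ :=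
  α v * β w - α w * β v

end Forms

/-! ### Pseudohermitian manifolds -/

/-- A real one-form `θ` and a field `J` of endomorphisms of the tangent spaces. Only the
restriction of `J` to `ker θ` is geometric; as usual `J` is extended by `0` to the Reeb
direction. -/
structure PHData (E : Type*) [NormedAddCommGroup E] [NormedSpace ℝ E]
    (M : Type*) [TopologicalSpace M] [ChartedSpace E M] where
  θ : ∀ x : M, TangentSpace 𝓘(ℝ, E) x →L[ℝ] ℝ
  J : ∀ x : M, TangentSpace 𝓘(ℝ, E) x →L[ℝ] TangentSpace 𝓘(ℝ, E) x

section PH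

variable {E : Type*} [NormedAddCommGroup E] [NormedSpace ℝ E]
  {M : Type*} [TopologicalSpace M] [ChartedSpace E M]
  {E' : Type*} [NormedAddCommGroup E'] [NormedSpace ℝ E']
  {N : Type*} [TopologicalSpace N] [ChartedSpace E' N]

variable [IsManifold 𝓘(ℝ, E) ∞ M] in
/-- `(M, J, θ)` is a (strictly pseudoconvex) pseudohermitian manifold of CR dimension `m`. -/
structure PHData.IsPseudohermitian (S : PHData E M) (m : ℕ) : Prop where
  dim : Module.finrank ℝ E = 2 * m + 1
  smooth_θ : SmoothFormOn S.θ Set.univ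
  smooth_J : ∀ x₀ : M, ContDiffOn ℝ ∞ (endoInChart S.J x₀) (extChartAt 𝓘(ℝ, E) x₀).target
  θ_ne_zero : ∀ x, S.θ x ≠ 0
  J_mem : ∀ x v, S.θ x v = 0 → S.θ x (S.J x v) = 0
  J_sq : ∀ x v, S.θ x v = 0 → S.J x (S.J x v) = -v
  J_reeb : ∀ x v, (∀ w, extD S.θ x v w = 0) → S.J x v = 0
  levi_pos : ∀ x v, S.θ x v = 0 → v ≠ 0 → 0 < extD S.θ x v (S.J x v)
  integrable : ∀ U : Set M, IsOpen U → ∀ X Y : ∀ x : M, TangentSpace 𝓘(ℝ, E) x,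
    ContMDiffOn 𝓘(ℝ, E) 𝓘(ℝ, E).tangent ∞ (fun x => (X x : TangentBundle 𝓘(ℝ, E) M)) U →
    ContMDiffOn 𝓘(ℝ, E) 𝓘(ℝ, E).tangent ∞ (fun x => (Y x : TangentBundle 𝓘(ℝ, E) M)) U →
    (∀ x ∈ U, S.θ x (X x) = 0) → (∀ x ∈ U, S.θ x (Y x) = 0) → ∀ x ∈ U,
      let JX := fun y => S.J y (X y)
      let JY := fun y => S.J y (Y y)
      let A := VectorField.mlieBracket 𝓘(ℝ, E) X JY x + VectorField.mlieBracket 𝓘(ℝ, E) JX Y x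
      S.θ x A = 0 ∧
      S.J x A = VectorField.mlieBracket 𝓘(ℝ, E) JX JY x - VectorField.mlieBracket 𝓘(ℝ, E) X Y x

/-- A diffeomorphism `φ` is a pseudohermitian transformation if `φ^* θ' = θ` and
`φ_* ∘ J = J' ∘ φ_*` on the contact bundle `ker θ`. -/
def IsPHTransformation (S : PHData E M) (S' : PHData E' N)
    (φ : M ≃ₘ^∞⟮𝓘(ℝ, E), 𝓘(ℝ, E')⟯ N) : Prop :=
  (∀ x v, S'.θ (φ x) (mfderiv 𝓘(ℝ, E) 𝓘(ℝ, E') φ x v) = S.θ x v) ∧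
  (∀ x v, S.θ x v = 0 →
    mfderiv 𝓘(ℝ, E) 𝓘(ℝ, E') φ x (S.J x v) = S'.J (φ x) (mfderiv 𝓘(ℝ, E) 𝓘(ℝ, E') φ x v))

/-- The frame `Z_j = (e_j - i J e_j) / 2` of `T_{1,0}` over `U` is unitary with dual coframe `η`
(`η^j` is of type `(1,0)` and annihilates the Reeb field, and `dθ = i ∑ η^j ∧ conj η^j`), and
`Γ j k = Γ_j^k` and `τ^j = ∑ A j k conj η^k` are its pseudohermitian (Tanaka-Webster) connection
and torsion forms. -/
structure IsWebsterConnection (S : PHData E M) {m : ℕ} (U : Set M)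
    (e : Fin m → ∀ x : M, TangentSpace 𝓘(ℝ, E) x)
    (η : Fin m → ∀ x : M, TangentSpace 𝓘(ℝ, E) x →L[ℝ] ℂ)
    (Γ : Fin m → Fin m → ∀ x : M, TangentSpace 𝓘(ℝ, E) x →L[ℝ] ℂ)
    (A : Fin m → Fin m → M → ℂ) : Prop where
  smooth_η : ∀ j, SmoothFormOn (η j) U
  smooth_Γ : ∀ j k, SmoothFormOn (Γ j k) U
  horizontal : ∀ x ∈ U, ∀ j, S.θ x (e j x) = 0
  dual : ∀ x ∈ U, ∀ j k, η j x (e k x) = if j = k then 1 else 0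
  type_one_zero : ∀ x ∈ U, ∀ j v, η j x (S.J x v) = Complex.I * η j x v
  unitary : ∀ x ∈ U, ∀ v w, ((extD S.θ x v w : ℝ) : ℂ) =
    Complex.I * ∑ j, (η j x v * (starRingEnd ℂ) (η j x w) - η j x w * (starRingEnd ℂ) (η j x v))
  structure_eq : ∀ x ∈ U, ∀ j v w, extD (η j) x v w =
    (∑ k, wedge (η k x) (Γ k j x) v w) +
      ∑ k, A j k x * (S.θ x v * (starRingEnd ℂ) (η k x w) - S.θ x w * (starRingEnd ℂ) (η k x v))
  skew : ∀ x ∈ U, ∀ j k v, Γ j k x v + (starRingEnd ℂ) (Γ k j x v) = 0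

/-- The coefficient `R_{j \bar l p \bar q} = Π_j^l (Z_p, \bar Z_q)` of the Webster curvature with
respect to the unitary frame `Z_j = (e_j - i J e_j) / 2` with connection forms `Γ`, where
`Π_j^l = dΓ_j^l - ∑ Γ_j^k ∧ Γ_k^l`. -/
def websterCurvature (S : PHData E M) {m : ℕ} (e : Fin m → ∀ x : M, TangentSpace 𝓘(ℝ, E) x)
    (Γ : Fin m → Fin m → ∀ x : M, TangentSpace 𝓘(ℝ, E) x →L[ℝ] ℂ) (x : M)
    (j l p q : Fin m) : ℂ :=
  let P : TangentSpace 𝓘(ℝ, E) x → TangentSpace 𝓘(ℝ, E) x → ℂ := fun v w =>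
    extD (Γ j l) x v w - ∑ k, wedge (Γ j k x) (Γ k l x) v w
  (1 / 4) * (P (e p x) (e q x) + Complex.I * P (e p x) (S.J x (e q x))
    - Complex.I * P (S.J x (e p x)) (e q x) + P (S.J x (e p x)) (S.J x (e q x)))

end PH

/-! ### The Heisenberg group -/

/-- The manifold `H_n = ℂⁿ × ℝ`, with points `(z, t)`, `z = x + i y`. -/
abbrev Heis (n : ℕ) : Type := EuclideanSpace ℂ (Fin n) × ℝ

/-- The contact form `Θ = dt + ∑ (x_β dy_β - y_β dx_β)` at `p`. -/
def heisΘ {n : ℕ} (p : Heis n) : Heis n →L[ℝ] ℝ :=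
  ContinuousLinearMap.snd ℝ (EuclideanSpace ℂ (Fin n)) ℝ +
    (Complex.imCLM.comp ((innerSL ℂ p.1).restrictScalars ℝ)).comp
      (ContinuousLinearMap.fst ℝ (EuclideanSpace ℂ (Fin n)) ℝ)

/-- Multiplication by `i` on `ℂⁿ`. -/
def mulI (n : ℕ) : EuclideanSpace ℂ (Fin n) →L[ℝ] EuclideanSpace ℂ (Fin n) :=
  (Complex.I • ContinuousLinearMap.id ℂ (EuclideanSpace ℂ (Fin n))).restrictScalars ℝ

/-- The CR structure of `H_n`: it exchanges the left invariant fields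
`∂/∂x_β + y_β ∂/∂t ↦ ∂/∂y_β - x_β ∂/∂t ↦ -(∂/∂x_β + y_β ∂/∂t)` and annihilates `T = ∂/∂t`; that
is, `(v, s)` goes to the horizontal lift of `i v`. -/
def heisJ {n : ℕ} (p : Heis n) : Heis n →L[ℝ] Heis n :=
  ((mulI n).comp (ContinuousLinearMap.fst ℝ (EuclideanSpace ℂ (Fin n)) ℝ)).prod
    (-((Complex.imCLM.comp ((innerSL ℂ p.1).restrictScalars ℝ)).comp
      ((mulI n).comp (ContinuousLinearMap.fst ℝ (EuclideanSpace ℂ (Fin n)) ℝ))))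

/-- The standard pseudohermitian structure of `H_n`. -/
def heisenberg (n : ℕ) : PHData (Heis n) (Heis n) where
  θ p := heisΘ p
  J p := heisJ p

/-- The Heisenberg rigid motions: the pseudohermitian transformations of `H_n`. -/
def IsRigidMotion {n : ℕ} (Φ : Heis n ≃ₘ^∞⟮𝓘(ℝ, Heis n), 𝓘(ℝ, Heis n)⟯ Heis n) : Prop :=
  IsPHTransformation (heisenberg n) (heisenberg n) Φ

/-! ### Pseudohermitian submanifolds of the Heisenberg group

The contact bundle of `H_n` is trivialized by the left invariant unitary frame
`\mathring Z_β = (1/2) (\mathring e_β - i J \mathring e_β)`: the horizontal vector `(v, s)`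
corresponds to `∑ v_β \mathring Z_β`, so that `T_{1,0} H_n = H_n × ℂⁿ`, with the standard Hermitian
product, and the pseudohermitian connection of `H_n`, for which this frame is parallel, is the
componentwise derivative. -/

/-- The model space of manifolds of dimension `2 m + 1`. -/
abbrev Model (m : ℕ) : Type := EuclideanSpace ℝ (Fin (2 * m + 1))

section Submanifold

variable {m n : ℕ} {M : Type*} [TopologicalSpace M] [ChartedSpace (Model m) M]

/-- The differential of `ι : M → H_n`. -/
def push (ι : M → Heis n) (x : M) : TangentSpace 𝓘(ℝ, Model m) x →L[ℝ] Heis n :=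
  mfderiv 𝓘(ℝ, Model m) 𝓘(ℝ, Heis n) ι x

/-- The differential of the `ℂⁿ`-component of `ι`. On horizontal vectors `v` it gives the
components of `ι_* v` in the left invariant frame. -/
def dz (ι : M → Heis n) (x : M) :
    TangentSpace 𝓘(ℝ, Model m) x →L[ℝ] EuclideanSpace ℂ (Fin n) :=
  (ContinuousLinearMap.fst ℝ (EuclideanSpace ℂ (Fin n)) ℝ).comp (push ι x)

/-- The differential of a map `ζ : M → ℂⁿ`. -/
def dvec (ζ : M → EuclideanSpace ℂ (Fin n)) (x : M) :
    TangentSpace 𝓘(ℝ, Model m) x →L[ℝ] EuclideanSpace ℂ (Fin n) :=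
  mfderiv 𝓘(ℝ, Model m) 𝓘(ℝ, EuclideanSpace ℂ (Fin n)) ζ x

variable [IsManifold 𝓘(ℝ, Model m) ∞ M] in
/-- `(M, J, θ)`, immersed in `H_n` by `ι`, is a pseudohermitian submanifold of CR dimension `m`:
the contact form and the CR structure of `M` are the restrictions of those of `H_n`. -/
structure IsPHSubmanifold (S : PHData (Model m) M) (ι : M → Heis n) : Prop where
  pseudohermitian : S.IsPseudohermitian m
  smooth : ContMDiff 𝓘(ℝ, Model m) 𝓘(ℝ, Heis n) ∞ ι
  immersion : ∀ x : M, Function.Injective (push (m := m) ι x)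
  θ_eq : ∀ x v, S.θ x v = heisΘ (ι x) (push ι x v)
  J_eq : ∀ x v, S.θ x v = 0 → push ι x (S.J x v) = heisJ (ι x) (push ι x v)

/-- `ν` is the fundamental vector at `x`: it is horizontal, orthogonal to the contact space of
`M`, and `T + ν` is tangent to `M`. -/
def IsFundamentalVector (S : PHData (Model m) M) (ι : M → Heis n) (x : M) (ν : Heis n) : Prop :=
  heisΘ (ι x) ν = 0 ∧
  (∀ v, S.θ x v = 0 → (inner ℂ (dz ι x v) ν.1).re = 0) ∧
  ∃ v : TangentSpace 𝓘(ℝ, Model m) x, push ι x v = ((0, 1) : Heis n) + ν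

/-- The submanifold is vertical: its fundamental vector field vanishes identically. -/
def IsVertical (S : PHData (Model m) M) (ι : M → Heis n) : Prop :=
  ∀ x, IsFundamentalVector S ι x 0

/-- `ζ` is a smooth section over `U` of the normal bundle: the orthogonal complement of the
`(1,0)` contact bundle of `M` in that of `H_n`. -/
def IsNormalOn (S : PHData (Model m) M) (ι : M → Heis n) (U : Set M)
    (ζ : M → EuclideanSpace ℂ (Fin n)) : Prop :=
  ContMDiffOn 𝓘(ℝ, Model m) 𝓘(ℝ, EuclideanSpace ℂ (Fin n)) ∞ ζ U ∧
  ∀ x ∈ U, ∀ v, S.θ x v = 0 → inner ℂ (dz ι x v) (ζ x) = 0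

/-- The component `II^ζ (X, Y) = -⟨X_{1,0}, ∇_{\bar Y_{1,0}} ζ⟩` of the second fundamental form
along the normal section `ζ`, where `X, Y` are contact vectors of `M`,
`X_{1,0} = (X - i J X) / 2`, and `⟨ , ⟩` is linear in the first variable. -/
def secondForm (S : PHData (Model m) M) (ι : M → Heis n) (ζ : M → EuclideanSpace ℂ (Fin n))
    (x : M) (X Y : TangentSpace 𝓘(ℝ, Model m) x) : ℂ :=
  -inner ℂ ((1 / 2 : ℂ) • (dvec ζ x Y + Complex.I • dvec ζ x (S.J x Y))) (dz ι x X)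

/-- The point `x` is flat: the second fundamental form vanishes at `x`. -/
def IsFlatPoint (S : PHData (Model m) M) (ι : M → Heis n) (x : M) : Prop :=
  ∀ U : Set M, IsOpen U → x ∈ U → ∀ ζ, IsNormalOn S ι U ζ →
    ∀ X Y, S.θ x X = 0 → S.θ x Y = 0 → secondForm S ι ζ x X Y = 0

/-- A Darboux frame over `U` in CR codimension one: `e_j` are smooth contact fields of `M`, `ζ` is
a smooth normal section, and the vectors `Z_1 = ι_* e_1, …, Z_m = ι_* e_m, Z_{m+1} = ζ` of
`T_{1,0} H_{m+1}` form a unitary frame. -/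
structure IsDarbouxFrame (S : PHData (Model m) M) (ι : M → Heis (m + 1)) (U : Set M)
    (e : Fin m → ∀ x : M, TangentSpace 𝓘(ℝ, Model m) x)
    (ζ : M → EuclideanSpace ℂ (Fin (m + 1))) : Prop where
  horizontal : ∀ x ∈ U, ∀ j, S.θ x (e j x) = 0
  smooth : ∀ j, ContMDiffOn 𝓘(ℝ, Model m) 𝓘(ℝ, EuclideanSpace ℂ (Fin (m + 1))) ∞
    (fun x => dz ι x (e j x)) U
  orthonormal : ∀ x ∈ U, Orthonormal ℂ (fun j => dz ι x (e j x))
  normal : IsNormalOn S ι U ζ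
  unit : ∀ x ∈ U, ‖ζ x‖ = 1

/-- The coefficients `h_{jk} = II^ζ (Z_j, Z_k)` of the second fundamental form. -/
def secondCoeff (S : PHData (Model m) M) (ι : M → Heis n)
    (e : Fin m → ∀ x : M, TangentSpace 𝓘(ℝ, Model m) x) (ζ : M → EuclideanSpace ℂ (Fin n))
    (x : M) (j k : Fin m) : ℂ :=
  secondForm S ι ζ x (e j x) (e k x)

/-- The connection form `⟨∇ Z, W⟩` of `H_n` along `M`, for sections `Z, W : M → ℂⁿ` of
`T_{1,0} H_n`. -/
def connForm (Z W : M → EuclideanSpace ℂ (Fin n)) (x : M) :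
    TangentSpace 𝓘(ℝ, Model m) x →L[ℝ] ℂ :=
  ((innerSL ℂ (W x)).restrictScalars ℝ).comp (dvec Z x)

/-- The form `θ_j^n = ⟨∇ Z_j, ζ⟩` of a Darboux frame. -/
def mixedForm (ι : M → Heis n) (e : Fin m → ∀ x : M, TangentSpace 𝓘(ℝ, Model m) x)
    (ζ : M → EuclideanSpace ℂ (Fin n)) (j : Fin m) (x : M) :
    TangentSpace 𝓘(ℝ, Model m) x →L[ℝ] ℂ :=
  connForm (fun y => dz ι y (e j y)) ζ x

/-- The form `θ_n^n = ⟨∇ ζ, ζ⟩` of the normal connection `∇^⊥ ζ = θ_n^n ⊗ ζ`, for a unit normal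
section `ζ` in CR codimension one. -/
def normalForm (ζ : M → EuclideanSpace ℂ (Fin n)) (x : M) :
    TangentSpace 𝓘(ℝ, Model m) x →L[ℝ] ℂ :=
  connForm ζ ζ x

end Submanifold

end Pseudohermitian

end

open Pseudohermitian

/-! Let z be the ℂⁿ-component of the immersion. On a vertical M the vector ∂/∂t is tangent, dz kills
exactly the Reeb line, and dz ∘ J = i dz holds on the whole tangent space, J being 0 on that line.
Since dΘ is twice the imaginary part of the Hermitian product, ⟨dz v, dz w⟩ is expressed by dθ and J
alone (`inner_dz`). Thus ι_M and ι_N ∘ φ yield two J-holomorphic maps f, g with the same induced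
Hermitian form. This is a rigidity problem of Calabi's type, treated with real derivatives in a
chart, where J is variable.

Symmetry of higher derivatives, played against complex linearity and antilinearity, shows that the
Hermitian products of derivatives of orders (2,1), (2,2), (3,1) and (3,2) agree for f and g. In CR
codimension one the derivatives of orders 1 and 2 span at a point that is not flat
(`span_jetFamily`). Equal Gram matrices then give a unitary U(y) from the jets of f to those of g,
and the third order identities force dU = 0 (`exists_isometry`). Connectedness makes U global, and
integrating dz and θ yields a rigid motion (`exists_congruence`).

For the structure equations, a Darboux frame is a moving frame in the flat bundle M × ℂⁿ. Its forms
are ⟨dZ, W⟩, their exterior derivatives contain only dW and dZ (`extD_connForm`), and Parseval's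
identity splits these into tangential and normal parts. The tangential forms satisfy the Webster
axioms with torsion 0, hence are the Webster forms (`conn_eq`); the normal parts give the Gauss and
Codazzi equations. Some h_{jk} is nonzero where M is not flat, which makes both equations determine
their unknowns. For the last claim the frame is carried along by the unitary part of the rigid
motion. -/

noncomputable section

namespace Pseudohermitian

/-! ### Differentials and exterior derivatives in charts -/

section ChartCalculus

variable {E : Type*} [NormedAddCommGroup E] [NormedSpace ℝ E]
  {M : Type*} [TopologicalSpace M] [ChartedSpace E M]
  {F : Type*} [NormedAddCommGroup F] [NormedSpace ℝ F]
  {W : Type*} [NormedAddCommGroup W] [NormedSpace ℝ W]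

/-- The differential at the centre of a chart is the derivative of the expression in this chart. -/
theorem fderiv_comp_extChartAt_symm_self {B : M → W} {x : M}
    (hB : MDifferentiableAt 𝓘(ℝ, E) 𝓘(ℝ, W) B x) :
    fderiv ℝ (B ∘ (extChartAt 𝓘(ℝ, E) x).symm) (extChartAt 𝓘(ℝ, E) x x) =
      mfderiv 𝓘(ℝ, E) 𝓘(ℝ, W) B x := by
  rw [hB.mfderiv]
  simp only [mfld_simps, fderivWithin_univ]
  rfl

theorem eventually_extChartAt_symm {p : M → Prop} {x : M} (h : ∀ᶠ x' in nhds x, p x') :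
    ∀ᶠ y in nhds (extChartAt 𝓘(ℝ, E) x x), p ((extChartAt 𝓘(ℝ, E) x).symm y) := by
  have hc := continuousAt_extChartAt_symm (I := 𝓘(ℝ, E)) x
  have : Filter.Tendsto (extChartAt 𝓘(ℝ, E) x).symm (nhds (extChartAt 𝓘(ℝ, E) x x)) (nhds x) := by
    simpa [ContinuousAt] using hc
  exact this.eventually h

theorem extD_congr {κ κ' : ∀ x : M, TangentSpace 𝓘(ℝ, E) x →L[ℝ] F} {x : M}
    (h : ∀ᶠ x' in nhds x, κ x' = κ' x') : extD κ x = extD κ' x := by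
  have : formInChart κ x =ᶠ[nhds (extChartAt 𝓘(ℝ, E) x x)] formInChart κ' x := by
    filter_upwards [eventually_extChartAt_symm h] with y hy
    simp only [formInChart, hy]
  funext v w
  simp only [extD, this.fderiv_eq]

variable [IsManifold 𝓘(ℝ, E) ∞ M]

theorem one_le_infty : (1 : WithTop ℕ∞) ≤ ∞ := by exact_mod_cast le_top

theorem two_le_infty : (2 : WithTop ℕ∞) ≤ ∞ := ENat.LEInfty.out

theorem isManifold_one : IsManifold 𝓘(ℝ, E) 1 M := IsManifold.of_le (n := ∞) one_le_infty

theorem contMDiffAt_extChartAt_symm {x₀ : M} {y : E} (hy : y ∈ (extChartAt 𝓘(ℝ, E) x₀).target) :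
    ContMDiffAt 𝓘(ℝ, E) 𝓘(ℝ, E) ∞ (extChartAt 𝓘(ℝ, E) x₀).symm y :=
  (contMDiffOn_extChartAt_symm x₀).contMDiffAt ((isOpen_extChartAt_target x₀).mem_nhds hy)

theorem fderiv_comp_extChartAt_symm {B : M → W} {x₀ : M} {y : E}
    (hy : y ∈ (extChartAt 𝓘(ℝ, E) x₀).target)
    (hB : MDifferentiableAt 𝓘(ℝ, E) 𝓘(ℝ, W) B ((extChartAt 𝓘(ℝ, E) x₀).symm y)) :
    fderiv ℝ (B ∘ (extChartAt 𝓘(ℝ, E) x₀).symm) y =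
      (mfderiv 𝓘(ℝ, E) 𝓘(ℝ, W) B ((extChartAt 𝓘(ℝ, E) x₀).symm y)).comp
        (mfderiv 𝓘(ℝ, E) 𝓘(ℝ, E) (extChartAt 𝓘(ℝ, E) x₀).symm y) := by
  rw [← mfderiv_eq_fderiv]
  exact mfderiv_comp y hB ((contMDiffAt_extChartAt_symm hy).mdifferentiableAt (by simp))

theorem formInChart_comp_mfderiv (a : M → W →L[ℝ] F) {B : M → W} {x₀ : M} {y : E}
    (hy : y ∈ (extChartAt 𝓘(ℝ, E) x₀).target)
    (hB : MDifferentiableAt 𝓘(ℝ, E) 𝓘(ℝ, W) B ((extChartAt 𝓘(ℝ, E) x₀).symm y)) :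
    formInChart (fun x => (a x).comp (mfderiv 𝓘(ℝ, E) 𝓘(ℝ, W) B x)) x₀ y =
      (a ((extChartAt 𝓘(ℝ, E) x₀).symm y)).comp
        (fderiv ℝ (B ∘ (extChartAt 𝓘(ℝ, E) x₀).symm) y) := by
  rw [fderiv_comp_extChartAt_symm hy hB]
  rfl

theorem contDiffAt_comp_extChartAt_symm {B : M → W} {x₀ : M} {y : E} {n : WithTop ℕ∞}
    (hn : n ≤ ∞)
    (hy : y ∈ (extChartAt 𝓘(ℝ, E) x₀).target)
    (hB : ContMDiffAt 𝓘(ℝ, E) 𝓘(ℝ, W) n B ((extChartAt 𝓘(ℝ, E) x₀).symm y)) :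
    ContDiffAt ℝ n (B ∘ (extChartAt 𝓘(ℝ, E) x₀).symm) y := by
  rw [← contMDiffAt_iff_contDiffAt]
  exact hB.comp y ((contMDiffAt_extChartAt_symm hy).of_le hn)

theorem smoothFormOn_comp_mfderiv {U : Set M} (hU : IsOpen U) {a : M → W →L[ℝ] F} {B : M → W}
    (ha : ContMDiffOn 𝓘(ℝ, E) 𝓘(ℝ, W →L[ℝ] F) ∞ a U)
    (hB : ContMDiffOn 𝓘(ℝ, E) 𝓘(ℝ, W) ∞ B U) :
    SmoothFormOn (fun x => (a x).comp (mfderiv 𝓘(ℝ, E) 𝓘(ℝ, W) B x)) U := by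
  intro x₀
  have key : ContDiffOn ℝ ∞ (fun y => (a ((extChartAt 𝓘(ℝ, E) x₀).symm y)).comp
        (fderiv ℝ (B ∘ (extChartAt 𝓘(ℝ, E) x₀).symm) y))
      ((extChartAt 𝓘(ℝ, E) x₀).target ∩ (extChartAt 𝓘(ℝ, E) x₀).symm ⁻¹' U) := by
    rintro y ⟨hy, hyU⟩
    refine ContDiffAt.contDiffWithinAt ?_
    have h1 := contDiffAt_comp_extChartAt_symm le_rfl hy (ha.contMDiffAt (hU.mem_nhds hyU))
    have h2 := contDiffAt_comp_extChartAt_symm le_rfl hy (hB.contMDiffAt (hU.mem_nhds hyU))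
    exact ContDiffAt.clm_comp h1 (h2.fderiv_right (m := ∞) (by simp))
  refine key.congr ?_
  rintro y ⟨hy, hyU⟩
  exact formInChart_comp_mfderiv a hy
    ((hB.contMDiffAt (hU.mem_nhds hyU)).mdifferentiableAt (by simp))

/-- The derivative of a · dB is da ∧ dB because second derivatives of B in the chart are symmetric.
The contact form and all forms of a frame have this shape, so no other exterior derivative has to be
computed. -/
theorem extD_comp_mfderiv {a : M → W →L[ℝ] F} {B : M → W} {x : M}
    (ha : MDifferentiableAt 𝓘(ℝ, E) 𝓘(ℝ, W →L[ℝ] F) a x)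
    (hB : ContMDiffAt 𝓘(ℝ, E) 𝓘(ℝ, W) 2 B x) (v w : TangentSpace 𝓘(ℝ, E) x) :
    extD (fun x => (a x).comp (mfderiv 𝓘(ℝ, E) 𝓘(ℝ, W) B x)) x v w =
      (show W →L[ℝ] F from mfderiv 𝓘(ℝ, E) 𝓘(ℝ, W →L[ℝ] F) a x v)
          (mfderiv 𝓘(ℝ, E) 𝓘(ℝ, W) B x w) -
        (show W →L[ℝ] F from mfderiv 𝓘(ℝ, E) 𝓘(ℝ, W →L[ℝ] F) a x w)
          (mfderiv 𝓘(ℝ, E) 𝓘(ℝ, W) B x v) := by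
  set c := extChartAt 𝓘(ℝ, E) x with hc
  have hM1 : IsManifold 𝓘(ℝ, E) 1 M := isManifold_one
  have hM2 : IsManifold 𝓘(ℝ, E) 2 M := IsManifold.of_le (n := ∞) two_le_infty
  have hct : c x ∈ c.target := mem_extChartAt_target x
  have hsx : c.symm (c x) = x := extChartAt_to_inv x
  have hev : ∀ᶠ x' in nhds x, MDifferentiableAt 𝓘(ℝ, E) 𝓘(ℝ, W) B x' := by
    filter_upwards [(contMDiffAt_iff_contMDiffAt_nhds (by decide)).1 hB] with x' hx'
    exact hx'.mdifferentiableAt (by simp)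
  have h1 : formInChart (fun x => (a x).comp (mfderiv 𝓘(ℝ, E) 𝓘(ℝ, W) B x)) x =ᶠ[nhds (c x)]
      fun y => ((a ∘ c.symm) y).comp (fderiv ℝ (B ∘ c.symm) y) := by
    filter_upwards [eventually_extChartAt_symm hev, extChartAt_target_mem_nhds x] with y hy hy'
    exact formInChart_comp_mfderiv a hy' hy
  have hBc : ContDiffAt ℝ 2 (B ∘ c.symm) (c x) :=
    contDiffAt_comp_extChartAt_symm two_le_infty hct (by rw [← hc, hsx]; exact hB)
  have hac : DifferentiableAt ℝ (a ∘ c.symm) (c x) := by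
    rw [← mdifferentiableAt_iff_differentiableAt]
    refine MDifferentiableAt.comp (c x) (I' := 𝓘(ℝ, E)) (by rw [hsx]; exact ha) ?_
    exact (contMDiffAt_extChartAt_symm hct).mdifferentiableAt (by simp)
  have hsym := hBc.isSymmSndFDerivAt (by simp)
  have hB' : DifferentiableAt ℝ (fderiv ℝ (B ∘ c.symm)) (c x) :=
    (hBc.fderiv_right (m := 1) (by norm_num)).differentiableAt (by simp)
  have hda := fderiv_comp_extChartAt_symm_self ha
  have hdB := fderiv_comp_extChartAt_symm_self (hB.mdifferentiableAt (by simp))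
  simp only [extD]
  rw [← hc, h1.fderiv_eq]
  have := (hac.hasFDerivAt.clm_comp hB'.hasFDerivAt).fderiv
  have e1 : ∀ v w : E, fderiv ℝ (fun y => ((a ∘ c.symm) y).comp (fderiv ℝ (B ∘ c.symm) y)) (c x) v w
      = a x (fderiv ℝ (fderiv ℝ (B ∘ c.symm)) (c x) v w) +
        (fderiv ℝ (a ∘ c.symm) (c x) v) (fderiv ℝ (B ∘ c.symm) (c x) w) := by
    intro v w
    rw [this]
    simp [hsx]
  rw [← hda, ← hdB]
  have e2 := hsym.eq v w
  refine (congrArg₂ (· - ·) (e1 v w) (e1 w v)).trans ?_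
  rw [e2]
  simp only [add_sub_add_left_eq_sub]
  rfl

/-- A map with vanishing differential on a connected manifold is constant. -/
theorem eq_of_mfderiv_eq_zero [PreconnectedSpace M] {f : M → W}
    (hf : ∀ x, MDifferentiableAt 𝓘(ℝ, E) 𝓘(ℝ, W) f x)
    (h : ∀ x, mfderiv 𝓘(ℝ, E) 𝓘(ℝ, W) f x = 0) (x y : M) : f x = f y := by
  refine IsLocallyConstant.apply_eq_of_preconnectedSpace ?_ x y
  rw [IsLocallyConstant.iff_eventually_eq]
  intro x
  set c := extChartAt 𝓘(ℝ, E) x with hc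
  have hM1 : IsManifold 𝓘(ℝ, E) 1 M := isManifold_one
  obtain ⟨r, hr, hball⟩ := Metric.mem_nhds_iff.1 (extChartAt_target_mem_nhds (I := 𝓘(ℝ, E)) x)
  have hd : ∀ y ∈ Metric.ball (c x) r, HasFDerivAt (f ∘ c.symm) (0 : E →L[ℝ] W) y := by
    intro y hy
    have h1 : DifferentiableAt ℝ (f ∘ c.symm) y := by
      rw [← mdifferentiableAt_iff_differentiableAt]
      exact MDifferentiableAt.comp y (I' := 𝓘(ℝ, E)) (hf _)
        ((contMDiffAt_extChartAt_symm (hball hy)).mdifferentiableAt (by simp))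
    have h2 := fderiv_comp_extChartAt_symm (hball hy) (hf _)
    rw [h] at h2
    have h3 := h1.hasFDerivAt
    rw [h2] at h3
    exact h3.congr_fderiv (ContinuousLinearMap.zero_comp _)
  have hnear : ∀ᶠ x' in nhds x, c x' ∈ Metric.ball (c x) r :=
    (continuousAt_extChartAt x).eventually (Metric.ball_mem_nhds _ hr)
  filter_upwards [hnear, extChartAt_source_mem_nhds (I := 𝓘(ℝ, E)) x] with x' h1 h2
  have := (convex_ball (c x) r).is_const_of_fderivWithin_eq_zero (𝕜 := ℝ) (f := f ∘ c.symm)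
    (fun y hy => (hd y hy).differentiableAt.differentiableWithinAt)
    (fun y hy => by
      rw [fderivWithin_of_isOpen Metric.isOpen_ball hy, (hd y hy).fderiv]) h1
    (Metric.mem_ball_self hr)
  have e1 : c.symm (c x) = x := extChartAt_to_inv x
  have e2 : c.symm (c x') = x' := c.left_inv h2
  simpa [e1, e2] using this

end ChartCalculus

/-! ### Products of derivatives of two isometric J-holomorphic maps -/

section LocalRigidity

variable {E : Type*} [NormedAddCommGroup E] [NormedSpace ℝ E] {n : ℕ}

/-- `f` is smooth on the open set `Ω` and its differential intertwines the smooth field of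
endomorphisms `J` with the multiplication by `i`. -/
structure IsJHolomorphicOn (Ω : Set E) (J : E → E →L[ℝ] E) (f : E → EuclideanSpace ℂ (Fin n)) :
    Prop where
  isOpen : IsOpen Ω
  smooth : ContDiffOn ℝ ∞ f Ω
  smooth_J : ContDiffOn ℝ ∞ J Ω
  fderiv_J : ∀ y ∈ Ω, ∀ v, fderiv ℝ f y (J y v) = Complex.I • fderiv ℝ f y v

section Helpers

variable {G : Type*} [NormedAddCommGroup G] [NormedSpace ℝ G]
  {H : Type*} [NormedAddCommGroup H] [NormedSpace ℝ H]

theorem fderiv_contDiffAt_infty {f : E → G} {y : E} (h : ContDiffAt ℝ ∞ f y) :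
    ContDiffAt ℝ ∞ (fderiv ℝ f) y :=
  h.fderiv_right (m := ∞) (by simp)

theorem hasFDerivAt_of_contDiffAt_infty {f : E → G} {y : E} (h : ContDiffAt ℝ ∞ f y) :
    HasFDerivAt f (fderiv ℝ f y) y :=
  (h.differentiableAt (by simp)).hasFDerivAt

theorem hasFDerivAt_apply_const {a : E → H →L[ℝ] G} {a' : E →L[ℝ] H →L[ℝ] G} {y : E}
    (h : HasFDerivAt a a' y) (v : H) : HasFDerivAt (fun z => a z v) (a'.flip v) y := by
  simpa using h.clm_apply (hasFDerivAt_const v y)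

theorem fderiv_fderiv_comm {f : E → G} {y : E} (h : ContDiffAt ℝ ∞ f y) (u v : E) :
    fderiv ℝ (fderiv ℝ f) y u v = fderiv ℝ (fderiv ℝ f) y v u :=
  (h.isSymmSndFDerivAt (by simpa using two_le_infty)).eq u v

theorem inner_add_inner_of_eventuallyEq {a b a' b' : E → EuclideanSpace ℂ (Fin n)}
    {da db da' db' : E →L[ℝ] EuclideanSpace ℂ (Fin n)} {y : E}
    (h : ∀ᶠ z in nhds y, inner ℂ (a z) (b z) = inner ℂ (a' z) (b' z))
    (ha : HasFDerivAt a da y) (hb : HasFDerivAt b db y)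
    (ha' : HasFDerivAt a' da' y) (hb' : HasFDerivAt b' db' y) (s : E) :
    inner ℂ (a y) (db s) + inner ℂ (da s) (b y) =
      inner ℂ (a' y) (db' s) + inner ℂ (da' s) (b' y) := by
  have h1 := ha.inner ℂ hb
  have h2 := (ha'.inner ℂ hb').congr_of_eventuallyEq h
  simpa [fderivInnerCLM_apply] using DFunLike.congr_fun (h1.unique h2) s

end Helpers

namespace IsJHolomorphicOn

variable {Ω : Set E} {J : E → E →L[ℝ] E} {f g : E → EuclideanSpace ℂ (Fin n)} {y : E}

theorem contDiffAt (hf : IsJHolomorphicOn Ω J f) (hy : y ∈ Ω) : ContDiffAt ℝ ∞ f y :=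
  hf.smooth.contDiffAt (hf.isOpen.mem_nhds hy)

theorem contDiffAt_J (hf : IsJHolomorphicOn Ω J f) (hy : y ∈ Ω) : ContDiffAt ℝ ∞ J y :=
  hf.smooth_J.contDiffAt (hf.isOpen.mem_nhds hy)

theorem hasFDerivAt_fderiv_apply (hf : IsJHolomorphicOn Ω J f) (hy : y ∈ Ω) (v : E) :
    HasFDerivAt (fun z => fderiv ℝ f z v) ((fderiv ℝ (fderiv ℝ f) y).flip v) y :=
  hasFDerivAt_apply_const
    (hasFDerivAt_of_contDiffAt_infty (fderiv_contDiffAt_infty (hf.contDiffAt hy))) v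

theorem hasFDerivAt_fderiv2_apply (hf : IsJHolomorphicOn Ω J f) (hy : y ∈ Ω) (u v : E) :
    HasFDerivAt (fun z => fderiv ℝ (fderiv ℝ f) z u v)
      (((fderiv ℝ (fderiv ℝ (fderiv ℝ f)) y).flip u).flip v) y :=
  hasFDerivAt_apply_const (hasFDerivAt_apply_const (hasFDerivAt_of_contDiffAt_infty
    (fderiv_contDiffAt_infty (fderiv_contDiffAt_infty (hf.contDiffAt hy)))) u) v

theorem fderiv2_comm (hf : IsJHolomorphicOn Ω J f) (hy : y ∈ Ω) (u v : E) :
    fderiv ℝ (fderiv ℝ f) y u v = fderiv ℝ (fderiv ℝ f) y v u :=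
  fderiv_fderiv_comm (hf.contDiffAt hy) u v

theorem fderiv3_comm_left (hf : IsJHolomorphicOn Ω J f) (hy : y ∈ Ω) (s u v : E) :
    fderiv ℝ (fderiv ℝ (fderiv ℝ f)) y s u v = fderiv ℝ (fderiv ℝ (fderiv ℝ f)) y u s v := by
  rw [fderiv_fderiv_comm (fderiv_contDiffAt_infty (hf.contDiffAt hy)) s u]

theorem fderiv3_comm_right (hf : IsJHolomorphicOn Ω J f) (hy : y ∈ Ω) (s u v : E) :
    fderiv ℝ (fderiv ℝ (fderiv ℝ f)) y s u v = fderiv ℝ (fderiv ℝ (fderiv ℝ f)) y s v u := by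
  have h1 := hf.hasFDerivAt_fderiv2_apply hy u v
  have h2 := (hf.hasFDerivAt_fderiv2_apply hy v u).congr_of_eventuallyEq
    (f₁ := fun z => fderiv ℝ (fderiv ℝ f) z u v) (by
      filter_upwards [hf.isOpen.mem_nhds hy] with z hz using hf.fderiv2_comm hz u v)
  exact DFunLike.congr_fun (h1.unique h2) s

/-- J varies in the chart, so Leibniz adds a term of lower order in f. In the comparisons of f with
g such terms cancel, their products having been matched before. -/
theorem fderiv2_J (hf : IsJHolomorphicOn Ω J f) (hy : y ∈ Ω) (u v : E) :
    fderiv ℝ (fderiv ℝ f) y u (J y v) + fderiv ℝ f y (fderiv ℝ J y u v) =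
      Complex.I • fderiv ℝ (fderiv ℝ f) y u v := by
  have hA := hasFDerivAt_of_contDiffAt_infty (fderiv_contDiffAt_infty (hf.contDiffAt hy))
  have hJ := hasFDerivAt_apply_const (hasFDerivAt_of_contDiffAt_infty (hf.contDiffAt_J hy)) v
  have h1 := hA.clm_apply hJ
  have h2 := ((hf.hasFDerivAt_fderiv_apply hy v).const_smul Complex.I).congr_of_eventuallyEq
    (f₁ := fun z => fderiv ℝ f z (J z v)) (by
      filter_upwards [hf.isOpen.mem_nhds hy] with z hz using hf.fderiv_J z hz v)
  have := DFunLike.congr_fun (h1.unique h2) u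
  simp at this
  rw [← this, add_comm]

theorem fderiv3_J (hf : IsJHolomorphicOn Ω J f) (hy : y ∈ Ω) (s u v : E) :
    fderiv ℝ (fderiv ℝ (fderiv ℝ f)) y s u (J y v) +
      fderiv ℝ (fderiv ℝ f) y u (fderiv ℝ J y s v) +
      fderiv ℝ (fderiv ℝ f) y s (fderiv ℝ J y u v) +
      fderiv ℝ f y (fderiv ℝ (fderiv ℝ J) y s u v) =
      Complex.I • fderiv ℝ (fderiv ℝ (fderiv ℝ f)) y s u v := by
  have hcA := fderiv_contDiffAt_infty (hf.contDiffAt hy)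
  have hA := hasFDerivAt_of_contDiffAt_infty hcA
  have hB := hasFDerivAt_apply_const
    (hasFDerivAt_of_contDiffAt_infty (fderiv_contDiffAt_infty hcA)) u
  have hJ := hasFDerivAt_apply_const (hasFDerivAt_of_contDiffAt_infty (hf.contDiffAt_J hy)) v
  have hJ' := hasFDerivAt_apply_const (hasFDerivAt_apply_const
    (hasFDerivAt_of_contDiffAt_infty (fderiv_contDiffAt_infty (hf.contDiffAt_J hy))) u) v
  have h1 := (hB.clm_apply hJ).add (hA.clm_apply hJ')
  have h2 := ((hf.hasFDerivAt_fderiv2_apply hy u v).const_smul Complex.I).congr_of_eventuallyEq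
    (f₁ := fun z => fderiv ℝ (fderiv ℝ f) z u (J z v) + fderiv ℝ f z (fderiv ℝ J z u v)) (by
      filter_upwards [hf.isOpen.mem_nhds hy] with z hz using hf.fderiv2_J hz u v)
  have := DFunLike.congr_fun (h1.unique h2) s
  simp at this
  rw [← this]
  abel

end IsJHolomorphicOn

/-- Two `J`-holomorphic maps which induce the same Hermitian form. -/
structure IsIsometricPairOn (Ω : Set E) (J : E → E →L[ℝ] E)
    (f g : E → EuclideanSpace ℂ (Fin n)) : Prop where
  left : IsJHolomorphicOn Ω J f
  right : IsJHolomorphicOn Ω J g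
  inner_fderiv : ∀ y ∈ Ω, ∀ v w, inner ℂ (fderiv ℝ f y v) (fderiv ℝ f y w) =
    inner ℂ (fderiv ℝ g y v) (fderiv ℝ g y w)

namespace IsIsometricPairOn

variable {Ω : Set E} {J : E → E →L[ℝ] E} {f g : E → EuclideanSpace ℂ (Fin n)} {y : E}

/-- The difference T of the two sides is symmetric in u, v and skew-Hermitian in v, w. Its real part
vanishes by the argument that proves uniqueness of the Levi-Civita connection; replacing w by J w
then kills the imaginary part. -/
theorem inner_fderiv2_fderiv (h : IsIsometricPairOn Ω J f g) (hy : y ∈ Ω) (u v w : E) :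
    inner ℂ (fderiv ℝ (fderiv ℝ f) y u v) (fderiv ℝ f y w) =
      inner ℂ (fderiv ℝ (fderiv ℝ g) y u v) (fderiv ℝ g y w) := by
  set T : E → E → E → ℂ := fun u v w =>
    inner ℂ (fderiv ℝ (fderiv ℝ f) y u v) (fderiv ℝ f y w) -
      inner ℂ (fderiv ℝ (fderiv ℝ g) y u v) (fderiv ℝ g y w) with hT
  have hsymm : ∀ u v w, T u v w = T v u w := fun u v w => by
    simp only [hT, h.left.fderiv2_comm hy u v, h.right.fderiv2_comm hy u v]
  have hskew : ∀ u v w, T u v w = -(starRingEnd ℂ) (T u w v) := fun u v w => by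
    have := inner_add_inner_of_eventuallyEq
      (by filter_upwards [h.left.isOpen.mem_nhds hy] with z hz using h.inner_fderiv z hz v w)
      (h.left.hasFDerivAt_fderiv_apply hy v) (h.left.hasFDerivAt_fderiv_apply hy w)
      (h.right.hasFDerivAt_fderiv_apply hy v) (h.right.hasFDerivAt_fderiv_apply hy w) u
    simp only [ContinuousLinearMap.flip_apply] at this
    simp only [hT, map_sub, inner_conj_symm]
    linear_combination this
  have hJ : ∀ u v w, T u v (J y w) = Complex.I * T u v w := fun u v w => by
    simp only [hT, h.left.fderiv_J y hy, h.right.fderiv_J y hy, inner_smul_right]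
    ring
  have hre : ∀ u v w, (T u v w).re = 0 := fun u v w => by
    have e : ∀ u v w, (T u v w).re = -(T u w v).re := fun u v w => by
      conv_lhs => rw [hskew]
      simp
    have h1 := e u v w
    rw [hsymm u w v] at h1
    have h2 := e w u v
    rw [hsymm w v u] at h2
    have h3 := e v w u
    rw [hsymm v u w] at h3
    linarith
  have : T u v w = 0 := by
    apply Complex.ext
    · exact hre u v w
    · have := hre u v (J y w)
      rw [hJ] at this
      simpa using this
  simpa only [hT, sub_eq_zero] using this

theorem inner_fderiv_fderiv2 (h : IsIsometricPairOn Ω J f g) (hy : y ∈ Ω) (u v w : E) :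
    inner ℂ (fderiv ℝ f y w) (fderiv ℝ (fderiv ℝ f) y u v) =
      inner ℂ (fderiv ℝ g y w) (fderiv ℝ (fderiv ℝ g) y u v) := by
  rw [← inner_conj_symm, h.inner_fderiv2_fderiv hy, inner_conj_symm]

theorem inner_fderiv2_fderiv2_aux (h : IsIsometricPairOn Ω J f g) (hy : y ∈ Ω) (r u v w : E) :
    inner ℂ (fderiv ℝ (fderiv ℝ f) y u v) (fderiv ℝ (fderiv ℝ f) y r w) +
      inner ℂ (fderiv ℝ (fderiv ℝ (fderiv ℝ f)) y r u v) (fderiv ℝ f y w) =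
    inner ℂ (fderiv ℝ (fderiv ℝ g) y u v) (fderiv ℝ (fderiv ℝ g) y r w) +
      inner ℂ (fderiv ℝ (fderiv ℝ (fderiv ℝ g)) y r u v) (fderiv ℝ g y w) := by
  have := inner_add_inner_of_eventuallyEq
      (by filter_upwards [h.left.isOpen.mem_nhds hy] with z hz
            using h.inner_fderiv2_fderiv hz u v w)
      (h.left.hasFDerivAt_fderiv2_apply hy u v) (h.left.hasFDerivAt_fderiv_apply hy w)
      (h.right.hasFDerivAt_fderiv2_apply hy u v) (h.right.hasFDerivAt_fderiv_apply hy w) r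
  simpa using this

/-- Symmetry of the third derivative makes the difference q invariant under exchange of u and s. But
u sits in the antilinear factor and s in the linear one, so replacing u by J u multiplies q both by
-i and by i. -/
theorem inner_fderiv2_fderiv2 (h : IsIsometricPairOn Ω J f g) (hy : y ∈ Ω) (u v s w : E) :
    inner ℂ (fderiv ℝ (fderiv ℝ f) y u v) (fderiv ℝ (fderiv ℝ f) y s w) =
      inner ℂ (fderiv ℝ (fderiv ℝ g) y u v) (fderiv ℝ (fderiv ℝ g) y s w) := by
  set q : E → E → E → E → ℂ := fun u v s w =>
    inner ℂ (fderiv ℝ (fderiv ℝ f) y u v) (fderiv ℝ (fderiv ℝ f) y s w) -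
      inner ℂ (fderiv ℝ (fderiv ℝ g) y u v) (fderiv ℝ (fderiv ℝ g) y s w) with hq
  have hswap : ∀ u v s w, q u v s w = q s v u w := fun u v s w => by
    have h1 := h.inner_fderiv2_fderiv2_aux hy s u v w
    have h2 := h.inner_fderiv2_fderiv2_aux hy u s v w
    rw [h.left.fderiv3_comm_left hy u s v, h.right.fderiv3_comm_left hy u s v] at h2
    simp only [hq]
    linear_combination h1 - h2
  have hJ1 : ∀ u v s w, q u (J y v) s w = -Complex.I * q u v s w := fun u v s w => by
    simp only [hq, eq_sub_of_add_eq (h.left.fderiv2_J hy u v),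
      eq_sub_of_add_eq (h.right.fderiv2_J hy u v), inner_sub_left, inner_smul_left,
      h.inner_fderiv_fderiv2 hy, Complex.conj_I]
    ring
  have hJ2 : ∀ u v s w, q u v s (J y w) = Complex.I * q u v s w := fun u v s w => by
    simp only [hq, eq_sub_of_add_eq (h.left.fderiv2_J hy s w),
      eq_sub_of_add_eq (h.right.fderiv2_J hy s w), inner_sub_right, inner_smul_right,
      h.inner_fderiv2_fderiv hy]
    ring
  have hs1 : ∀ u v s w, q u v s w = q v u s w := fun u v s w => by
    simp only [hq, h.left.fderiv2_comm hy u v, h.right.fderiv2_comm hy u v]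
  have hs2 : ∀ u v s w, q u v s w = q u v w s := fun u v s w => by
    simp only [hq, h.left.fderiv2_comm hy s w, h.right.fderiv2_comm hy s w]
  have : q u v s w = 0 := by
    have h1 : q (J y u) v s w = -Complex.I * q u v s w := by
      rw [hs1, hJ1, hs1]
    have h2 : q (J y u) v s w = Complex.I * q u v s w := by
      rw [hswap, hs2, hJ2, hs2, hswap]
    have h3 : Complex.I * q u v s w = 0 := by linear_combination (h1 - h2) / 2
    simpa using h3
  simpa only [hq, sub_eq_zero] using this

theorem inner_fderiv3_fderiv (h : IsIsometricPairOn Ω J f g) (hy : y ∈ Ω) (r u v w : E) :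
    inner ℂ (fderiv ℝ (fderiv ℝ (fderiv ℝ f)) y r u v) (fderiv ℝ f y w) =
      inner ℂ (fderiv ℝ (fderiv ℝ (fderiv ℝ g)) y r u v) (fderiv ℝ g y w) := by
  have := h.inner_fderiv2_fderiv2_aux hy r u v w
  rwa [h.inner_fderiv2_fderiv2 hy, add_right_inj] at this

/-- The difference p is antilinear in v, hence also in r, as the third derivative is symmetric.
Differentiating the identity of order (2,2) gives a skew-Hermitian symmetry that keeps r fixed and
turns antilinearity in r into linearity; so p = 0. -/
theorem inner_fderiv3_fderiv2 (h : IsIsometricPairOn Ω J f g) (hy : y ∈ Ω) (r u v s w : E) :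
    inner ℂ (fderiv ℝ (fderiv ℝ (fderiv ℝ f)) y r u v) (fderiv ℝ (fderiv ℝ f) y s w) =
      inner ℂ (fderiv ℝ (fderiv ℝ (fderiv ℝ g)) y r u v) (fderiv ℝ (fderiv ℝ g) y s w) := by
  set p : E → E → E → E → E → ℂ := fun r u v s w =>
    inner ℂ (fderiv ℝ (fderiv ℝ (fderiv ℝ f)) y r u v) (fderiv ℝ (fderiv ℝ f) y s w) -
      inner ℂ (fderiv ℝ (fderiv ℝ (fderiv ℝ g)) y r u v) (fderiv ℝ (fderiv ℝ g) y s w) with hp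
  have hskew : ∀ r u v s w, p r u v s w = -(starRingEnd ℂ) (p r s w u v) := fun r u v s w => by
    have := inner_add_inner_of_eventuallyEq
      (by filter_upwards [h.left.isOpen.mem_nhds hy] with z hz
            using h.inner_fderiv2_fderiv2 hz u v s w)
      (h.left.hasFDerivAt_fderiv2_apply hy u v) (h.left.hasFDerivAt_fderiv2_apply hy s w)
      (h.right.hasFDerivAt_fderiv2_apply hy u v) (h.right.hasFDerivAt_fderiv2_apply hy s w) r
    simp only [ContinuousLinearMap.flip_apply] at this
    simp only [hp, map_sub, inner_conj_symm]
    linear_combination this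
  have hcomm : ∀ r u v s w, p r u v s w = p v u r s w := fun r u v s w => by
    simp only [hp]
    rw [h.left.fderiv3_comm_right hy r u v, h.right.fderiv3_comm_right hy r u v,
      h.left.fderiv3_comm_left hy r v u, h.right.fderiv3_comm_left hy r v u,
      h.left.fderiv3_comm_right hy v r u, h.right.fderiv3_comm_right hy v r u]
  have hJ : ∀ r u v s w, p r u (J y v) s w = -Complex.I * p r u v s w := fun r u v s w => by
    have e1 : ∀ a b c d e : EuclideanSpace ℂ (Fin n), a + b + c + d = e → a = e - b - c - d := by
      rintro a b c d e rfl; abel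
    simp only [hp, e1 _ _ _ _ _ (h.left.fderiv3_J hy r u v),
      e1 _ _ _ _ _ (h.right.fderiv3_J hy r u v), inner_sub_left, inner_smul_left,
      h.inner_fderiv_fderiv2 hy, h.inner_fderiv2_fderiv2 hy, Complex.conj_I]
    ring
  have hJ' : ∀ r u v s w, p (J y r) u v s w = -Complex.I * p r u v s w := fun r u v s w => by
    rw [hcomm, hJ, hcomm]
  have : p r u v s w = 0 := by
    have h1 := hskew (J y r) u v s w
    rw [hJ', hJ', map_mul] at h1
    have h2 := hskew r u v s w
    simp only [map_neg, Complex.conj_I, neg_neg] at h1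
    have h3 : Complex.I * p r u v s w = 0 := by
      linear_combination (-1/2) * h1 + Complex.I / 2 * h2
    simpa using h3
  simpa only [hp, sub_eq_zero] using this

end IsIsometricPairOn

end LocalRigidity

/-! ### Linear isometries from equal Gram matrices -/

section Transfer

variable {V V' : Type*} [NormedAddCommGroup V] [InnerProductSpace ℂ V]
  [NormedAddCommGroup V'] [InnerProductSpace ℂ V']

/-- Two families with the same Gram matrix, the first of which spans, correspond under a linear
isometry. -/
theorem exists_linearIsometry_of_gram_eq {κ : Type*} {w : κ → V} {w' : κ → V'}
    (hw : ⊤ ≤ Submodule.span ℂ (Set.range w))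
    (h : ∀ k l, inner ℂ (w k) (w l) = inner ℂ (w' k) (w' l)) :
    ∃ U : V →ₗᵢ[ℂ] V', ∀ k, U (w k) = w' k := by
  set L := Finsupp.linearCombination ℂ w
  set L' := Finsupp.linearCombination ℂ w'
  have hin : ∀ c d, inner ℂ (L c) (L d) = inner ℂ (L' c) (L' d) := fun c d => by
    simp only [L, L', Finsupp.linearCombination_apply, Finsupp.sum_inner, Finsupp.inner_sum,
      inner_smul_left, inner_smul_right, h]
  have hnorm : ∀ c, ‖L c‖ = ‖L' c‖ := fun c => by
    rw [@norm_eq_sqrt_re_inner ℂ, @norm_eq_sqrt_re_inner ℂ, hin]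
  have hsurj : L.range = ⊤ := by
    rw [Finsupp.range_linearCombination]
    exact top_le_iff.1 hw
  -- L and L' have equal norms on all coefficients, hence the same kernel, so `L' ∘ R` does not
  -- depend on the right inverse R.
  obtain ⟨R, hR⟩ := L.exists_rightInverse_of_surjective hsurj
  have hR' : ∀ x, L (R x) = x := fun x => DFunLike.congr_fun hR x
  refine ⟨⟨L' ∘ₗ R, fun x => ?_⟩, fun k => ?_⟩
  · rw [LinearMap.comp_apply, ← hnorm, hR']
  · have h1 : L (R (w k) - Finsupp.single k 1) = 0 := by
      rw [map_sub, hR', Finsupp.linearCombination_single, one_smul, sub_self]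
    have h2 : L' (R (w k) - Finsupp.single k 1) = 0 := by
      rw [← norm_eq_zero, ← hnorm, h1, norm_zero]
    rw [map_sub, Finsupp.linearCombination_single, one_smul, sub_eq_zero] at h2
    exact h2

theorem eq_zero_of_forall_inner_eq_zero {κ : Type*} {w : κ → V}
    (hw : ⊤ ≤ Submodule.span ℂ (Set.range w)) {x : V} (h : ∀ k, inner ℂ x (w k) = 0) : x = 0 := by
  have : ∀ z ∈ Submodule.span ℂ (Set.range w), inner ℂ x z = 0 := fun z hz => by
    induction hz using Submodule.span_induction with
    | mem z hz => obtain ⟨k, rfl⟩ := hz; exact h k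
    | zero => exact inner_zero_right x
    | add a b _ _ ha hb => rw [inner_add_right, ha, hb, add_zero]
    | smul c a _ ha => rw [inner_smul_right, ha, mul_zero]
  exact inner_self_eq_zero.1 (this x (hw trivial))

/-- U is onto by finite dimension, so x' = U z, and x - z is orthogonal to a spanning family. This
will apply to derivatives of jets, which are known only through their products with the jets. -/
theorem linearIsometry_apply_eq_of_inner_eq [FiniteDimensional ℂ V] (U : V →ₗᵢ[ℂ] V) {κ : Type*}
    {w w' : κ → V} (hw : ⊤ ≤ Submodule.span ℂ (Set.range w)) (hU : ∀ k, U (w k) = w' k)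
    {x x' : V} (h : ∀ k, inner ℂ x (w k) = inner ℂ x' (w' k)) : U x = x' := by
  obtain ⟨z, rfl⟩ := (LinearMap.injective_iff_surjective (f := U.toLinearMap)).1 U.injective x'
  have : x - z = 0 := eq_zero_of_forall_inner_eq_zero hw fun k => by
    have e := h k
    rw [← hU, LinearIsometry.coe_toLinearMap, U.inner_map_map] at e
    rw [inner_sub_left, e, sub_self]
  rw [sub_eq_zero] at this
  rw [this]; rfl

end Transfer

/-! ### Local congruence from spanning jets -/

section LocalRigidity

variable {E : Type*} [NormedAddCommGroup E] [NormedSpace ℝ E] {n : ℕ}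
  {Ω : Set E} {J : E → E →L[ℝ] E} {f g : E → EuclideanSpace ℂ (Fin n)} {y : E}

/-- The first and second derivatives of `f`, as one family of vectors. -/
def jetFamily (f : E → EuclideanSpace ℂ (Fin n)) (y : E) : E ⊕ E × E → EuclideanSpace ℂ (Fin n) :=
  Sum.elim (fun v => fderiv ℝ f y v) (fun p => fderiv ℝ (fderiv ℝ f) y p.1 p.2)

/-- The derivative of `jetFamily f`. -/
def jetFamilyDeriv (f : E → EuclideanSpace ℂ (Fin n)) (y : E) :
    E ⊕ E × E → E →L[ℝ] EuclideanSpace ℂ (Fin n) :=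
  Sum.elim (fun v => (fderiv ℝ (fderiv ℝ f) y).flip v)
    (fun p => ((fderiv ℝ (fderiv ℝ (fderiv ℝ f)) y).flip p.1).flip p.2)

theorem IsJHolomorphicOn.hasFDerivAt_jetFamily (hf : IsJHolomorphicOn Ω J f) (hy : y ∈ Ω)
    (k : E ⊕ E × E) : HasFDerivAt (fun z => jetFamily f z k) (jetFamilyDeriv f y k) y := by
  rcases k with v | ⟨u, v⟩
  · exact hf.hasFDerivAt_fderiv_apply hy v
  · exact hf.hasFDerivAt_fderiv2_apply hy u v

namespace IsIsometricPairOn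

theorem inner_jetFamily (h : IsIsometricPairOn Ω J f g) (hy : y ∈ Ω) (k l : E ⊕ E × E) :
    inner ℂ (jetFamily f y k) (jetFamily f y l) = inner ℂ (jetFamily g y k) (jetFamily g y l) := by
  rcases k with v | ⟨u, v⟩ <;> rcases l with s | ⟨s, w⟩
  · exact h.inner_fderiv y hy v s
  · exact h.inner_fderiv_fderiv2 hy s w v
  · exact h.inner_fderiv2_fderiv hy u v s
  · exact h.inner_fderiv2_fderiv2 hy u v s w

theorem inner_jetFamilyDeriv (h : IsIsometricPairOn Ω J f g) (hy : y ∈ Ω) (k : E ⊕ E × E) (r : E)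
    (l : E ⊕ E × E) : inner ℂ (jetFamilyDeriv f y k r) (jetFamily f y l) =
      inner ℂ (jetFamilyDeriv g y k r) (jetFamily g y l) := by
  rcases k with v | ⟨u, v⟩ <;> rcases l with s | ⟨s, w⟩
  · exact h.inner_fderiv2_fderiv hy r v s
  · exact h.inner_fderiv2_fderiv2 hy r v s w
  · exact h.inner_fderiv3_fderiv hy r u v s
  · exact h.inner_fderiv3_fderiv2 hy r u v s w

/-- The map `c ↦ ∑ c_k w_k`, as a function of the family `w`. -/
def sumCLM {κ : Type*} [Fintype κ] (w : κ → EuclideanSpace ℂ (Fin n)) :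
    (κ → ℂ) →L[ℂ] EuclideanSpace ℂ (Fin n) :=
  ∑ k, (ContinuousLinearMap.proj (R := ℂ) (φ := fun _ : κ => ℂ) k).smulRight (w k)

theorem sumCLM_apply {κ : Type*} [Fintype κ] (w : κ → EuclideanSpace ℂ (Fin n)) (c : κ → ℂ) :
    sumCLM w c = ∑ k, c k • w k := by
  simp [sumCLM]

theorem differentiableAt_sumCLM {κ : Type*} [Fintype κ] {w : E → κ → EuclideanSpace ℂ (Fin n)}
    (hw : ∀ k, DifferentiableAt ℝ (fun z => w z k) y) :
    DifferentiableAt ℝ (fun z => sumCLM (w z)) y := by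
  unfold sumCLM
  refine DifferentiableAt.fun_sum fun k _ => ?_
  exact ((ContinuousLinearMap.smulRightL ℂ (κ → ℂ) (EuclideanSpace ℂ (Fin n))
    (ContinuousLinearMap.proj k)).restrictScalars ℝ).differentiableAt.comp y (hw k)

/-- Local rigidity: if the first and second derivatives of `f` span the target, then `f` and `g`
are locally congruent. -/
theorem exists_isometry (h : IsIsometricPairOn Ω J f g) (hy : y ∈ Ω)
    (hspan : ⊤ ≤ Submodule.span ℂ (Set.range (jetFamily f y))) :
    ∃ U : EuclideanSpace ℂ (Fin n) →ₗᵢ[ℂ] EuclideanSpace ℂ (Fin n),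
      ∀ᶠ z in nhds y, ∀ v, fderiv ℝ g z v = U (fderiv ℝ f z v) := by
  -- A finite subfamily that is a basis at y, and so near y, exhibits U as a differentiable function
  -- of the point.
  obtain ⟨κ, a, -, ha, hli⟩ := exists_linearIndependent' ℂ (jetFamily f y)
  have : Finite κ := hli.finite
  have := Fintype.ofFinite κ
  let b : Module.Basis κ ℂ (EuclideanSpace ℂ (Fin n)) :=
    Module.Basis.mk hli (by rw [ha]; exact hspan)
  let F : E → (κ → ℂ) →L[ℂ] EuclideanSpace ℂ (Fin n) := fun z => sumCLM (jetFamily f z ∘ a)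
  let G : E → (κ → ℂ) →L[ℂ] EuclideanSpace ℂ (Fin n) := fun z => sumCLM (jetFamily g z ∘ a)
  have hF : ∀ z ∈ Ω, DifferentiableAt ℝ F z := fun z hz =>
    differentiableAt_sumCLM fun k => (h.left.hasFDerivAt_jetFamily hz (a k)).differentiableAt
  have hG : ∀ z ∈ Ω, DifferentiableAt ℝ G z := fun z hz =>
    differentiableAt_sumCLM fun k => (h.right.hasFDerivAt_jetFamily hz (a k)).differentiableAt
  let e : (κ → ℂ) ≃L[ℂ] EuclideanSpace ℂ (Fin n) := b.equivFun.symm.toContinuousLinearEquiv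
  have he : F y = e := by
    ext1 c
    simp [F, e, sumCLM_apply, Module.Basis.equivFun_symm_apply, b]
  -- Where F z is not invertible `inverse` has a default value; `hopen` keeps z away from such
  -- points.
  let U : E → EuclideanSpace ℂ (Fin n) →L[ℂ] EuclideanSpace ℂ (Fin n) := fun z =>
    (G z).comp (ContinuousLinearMap.inverse (F z))
  have hopen : ∀ᶠ z in nhds y, z ∈ Ω ∧ ∃ e' : (κ → ℂ) ≃L[ℂ] EuclideanSpace ℂ (Fin n), F z = e' := by
    have h1 := (hF y hy).continuousAt.preimage_mem_nhds
      (he ▸ ContinuousLinearEquiv.nhds e)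
    filter_upwards [h.left.isOpen.mem_nhds hy, h1] with z hz hz'
    obtain ⟨e', he'⟩ := hz'
    exact ⟨hz, e', he'.symm⟩
  -- By the Gram identities U z carries the whole jet family, not only the chosen basis, and is an
  -- isometry.
  have hUeq : ∀ z ∈ Ω, (∃ e' : (κ → ℂ) ≃L[ℂ] EuclideanSpace ℂ (Fin n), F z = e') →
      ⊤ ≤ Submodule.span ℂ (Set.range (jetFamily f z)) ∧
      ∃ U' : EuclideanSpace ℂ (Fin n) →ₗᵢ[ℂ] EuclideanSpace ℂ (Fin n),
        U'.toContinuousLinearMap = U z ∧ ∀ k, U' (jetFamily f z k) = jetFamily g z k := by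
    rintro z hz ⟨e', he'⟩
    have hsp : ⊤ ≤ Submodule.span ℂ (Set.range (jetFamily f z)) := by
      intro x _
      have : x = F z (e'.symm x) := by simp [he']
      rw [this, sumCLM_apply]
      exact Submodule.sum_mem _ fun k _ =>
        Submodule.smul_mem _ _ (Submodule.subset_span ⟨a k, rfl⟩)
    obtain ⟨U', hU'⟩ := exists_linearIsometry_of_gram_eq hsp (h.inner_jetFamily hz)
    refine ⟨hsp, U', ?_, hU'⟩
    ext1 x
    obtain ⟨c, rfl⟩ := e'.surjective x
    have h1 : e' c = ∑ k, c k • jetFamily f z (a k) := by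
      have : e' c = F z c := by rw [he']; rfl
      rw [this, sumCLM_apply]; rfl
    have h2 : U z (e' c) = ∑ k, c k • jetFamily g z (a k) := by
      simp only [U, he', ContinuousLinearMap.inverse_equiv, ContinuousLinearMap.comp_apply]
      simp [G, sumCLM_apply]
    rw [h2, h1]
    simp [hU']
  have hUd : ∀ z ∈ Ω, (∃ e' : (κ → ℂ) ≃L[ℂ] EuclideanSpace ℂ (Fin n), F z = e') →
      DifferentiableAt ℝ U z := by
    rintro z hz ⟨e', he'⟩
    have h1 : DifferentiableAt ℝ (ContinuousLinearMap.inverse (R := ℂ) (M := κ → ℂ)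
        (M₂ := EuclideanSpace ℂ (Fin n))) (F z) := by
      rw [he']
      exact ((contDiffAt_map_inverse (n := 1) e').differentiableAt (by simp)).restrictScalars ℝ
    have h2 := h1.comp z (hF z hz)
    have h3 := (((isBoundedBilinearMap_comp (𝕜 := ℂ)).differentiableAt
      (G z, ContinuousLinearMap.inverse (F z))).restrictScalars ℝ).comp z ((hG z hz).prodMk h2)
    exact h3
  have hU0 : ∀ᶠ z in nhds y, HasFDerivAt U
      (0 : E →L[ℝ] EuclideanSpace ℂ (Fin n) →L[ℂ] EuclideanSpace ℂ (Fin n)) z := by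
    filter_upwards [hopen.eventually_nhds] with z hz
    obtain ⟨hzΩ, hze⟩ := hz.self_of_nhds
    obtain ⟨hsp, U', hU'z, hU'⟩ := hUeq z hzΩ hze
    have hd := (hUd z hzΩ hze).hasFDerivAt
    suffices fderiv ℝ U z = 0 by rwa [this] at hd
    ext1 s
    -- Differentiate U(z) f_k(z) = g_k(z), where f_k, g_k are the jets. The third order identities
    -- give U f_k' = g_k', so U' f_k = 0.
    have hzero : ∀ k, fderiv ℝ U z s (jetFamily f z k) = 0 := by
      intro k
      have hb := (ContinuousLinearMap.restrictScalarsL ℂ (EuclideanSpace ℂ (Fin n))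
        (EuclideanSpace ℂ (Fin n)) ℝ ℝ).hasFDerivAt.comp z hd
      have h1 := hb.clm_apply (h.left.hasFDerivAt_jetFamily hzΩ k)
      have h2 := (h.right.hasFDerivAt_jetFamily hzΩ k).congr_of_eventuallyEq
        (f₁ := fun z => U z (jetFamily f z k)) (by
          filter_upwards [hz] with z' hz'
          obtain ⟨-, U'', e1, e2⟩ := hUeq z' hz'.1 hz'.2
          rw [← e1]
          exact e2 k)
      have h3 := DFunLike.congr_fun (h1.unique h2) s
      have h4 : U z (jetFamilyDeriv f z k s) = jetFamilyDeriv g z k s := by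
        rw [← hU'z]
        exact linearIsometry_apply_eq_of_inner_eq U' hsp hU' (h.inner_jetFamilyDeriv hzΩ k s)
      simp at h3
      rwa [h4, add_eq_left] at h3
    have : (fderiv ℝ U z s : EuclideanSpace ℂ (Fin n) →ₗ[ℂ] EuclideanSpace ℂ (Fin n)) = 0 :=
      LinearMap.ext_on_range (top_le_iff.1 hsp) (by simpa using hzero)
    ext1 x
    exact DFunLike.congr_fun this x
  obtain ⟨r, hr, hball⟩ := Metric.mem_nhds_iff.1 (hU0.and hopen)
  obtain ⟨-, U', hU'y, -⟩ := hUeq y hy ⟨e, he⟩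
  refine ⟨U', ?_⟩
  filter_upwards [Metric.ball_mem_nhds y hr] with z hz v
  have hc := (convex_ball y r).is_const_of_fderivWithin_eq_zero (𝕜 := ℝ) (f := U)
    (fun z hz => (hball hz).1.differentiableAt.differentiableWithinAt)
    (fun z hz => by
      rw [fderivWithin_of_isOpen Metric.isOpen_ball hz, (hball hz).1.fderiv]) hz
    (Metric.mem_ball_self hr)
  obtain ⟨-, U'', e1, e2⟩ := hUeq z (hball hz).2.1 (hball hz).2.2
  have e3 : ∀ x, U' x = U'' x := fun x => by
    have : U'.toContinuousLinearMap = U''.toContinuousLinearMap := by rw [e1, hU'y, hc]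
    exact DFunLike.congr_fun this x
  rw [e3]
  exact (e2 (Sum.inl v)).symm

end IsIsometricPairOn

end LocalRigidity

/-! ### The contact form of the Heisenberg group -/

section HeisenbergForm

variable {n : ℕ}

/-- The Hermitian product as a real bilinear map. -/
def innerR (n : ℕ) : EuclideanSpace ℂ (Fin n) →L[ℝ] EuclideanSpace ℂ (Fin n) →L[ℝ] ℂ :=
  (isBoundedBilinearMap_inner (𝕜 := ℂ) (E := EuclideanSpace ℂ (Fin n))).toContinuousLinearMap

@[simp] theorem innerR_apply (v w : EuclideanSpace ℂ (Fin n)) : innerR n v w = inner ℂ v w := rfl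

theorem heisΘ_apply (p w : Heis n) : heisΘ p w = w.2 + (inner ℂ p.1 w.1).im := rfl

theorem heisJ_fst (p w : Heis n) : (heisJ p w).1 = Complex.I • w.1 := rfl

theorem heisJ_snd (p w : Heis n) : (heisJ p w).2 = -(inner ℂ p.1 (Complex.I • w.1)).im := rfl

/-- The derivative of `heisΘ`. -/
def heisΘDeriv (n : ℕ) : Heis n →L[ℝ] Heis n →L[ℝ] ℝ :=
  (((ContinuousLinearMap.compL ℝ (Heis n) ℂ ℝ Complex.imCLM).comp
    ((ContinuousLinearMap.compL ℝ (Heis n) (EuclideanSpace ℂ (Fin n)) ℂ).flip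
      (ContinuousLinearMap.fst ℝ (EuclideanSpace ℂ (Fin n)) ℝ))).comp (innerR n)).comp
    (ContinuousLinearMap.fst ℝ (EuclideanSpace ℂ (Fin n)) ℝ)

theorem hasFDerivAt_heisΘ (p : Heis n) :
    HasFDerivAt (heisΘ : Heis n → Heis n →L[ℝ] ℝ) (heisΘDeriv n) p := by
  have : (heisΘ : Heis n → Heis n →L[ℝ] ℝ) = fun p =>
      ContinuousLinearMap.snd ℝ (EuclideanSpace ℂ (Fin n)) ℝ + heisΘDeriv n p := rfl
  rw [this]
  exact (heisΘDeriv n).hasFDerivAt.const_add _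

end HeisenbergForm

/-! ### Vertical submanifolds: the differential dz and the second fundamental form -/

section Submanifold

variable {m n : ℕ} {M : Type*} [TopologicalSpace M] [ChartedSpace (Model m) M]

theorem contMDiffAt_fst {ι : M → Heis n} {k : WithTop ℕ∞} {x : M}
    (h : ContMDiffAt 𝓘(ℝ, Model m) 𝓘(ℝ, Heis n) k ι x) :
    ContMDiffAt 𝓘(ℝ, Model m) 𝓘(ℝ, EuclideanSpace ℂ (Fin n)) k (fun y => (ι y).1) x :=
  ((ContinuousLinearMap.fst ℝ (EuclideanSpace ℂ (Fin n)) ℝ).contMDiff.contMDiffAt).comp x h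

theorem dvec_fst {ι : M → Heis n} {x : M}
    (h : MDifferentiableAt 𝓘(ℝ, Model m) 𝓘(ℝ, Heis n) ι x) :
    dvec (m := m) (fun y => (ι y).1) x = dz ι x := by
  have h1 := (ContinuousLinearMap.fst ℝ (EuclideanSpace ℂ (Fin n)) ℝ).hasMFDerivAt
    (x := ι x)
  exact (h1.comp x h.hasMFDerivAt).mfderiv

variable [IsManifold 𝓘(ℝ, Model m) ∞ M] {S : PHData (Model m) M} {ι : M → Heis n}

namespace IsPHSubmanifold

theorem contMDiffAt_fst (h : IsPHSubmanifold S ι) (x : M) :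
    ContMDiffAt 𝓘(ℝ, Model m) 𝓘(ℝ, EuclideanSpace ℂ (Fin n)) ∞ (fun y => (ι y).1) x :=
  Pseudohermitian.contMDiffAt_fst (h.smooth x)

theorem mdifferentiableAt (h : IsPHSubmanifold S ι) (x : M) :
    MDifferentiableAt 𝓘(ℝ, Model m) 𝓘(ℝ, Heis n) ι x :=
  (h.smooth x).mdifferentiableAt (by simp)

theorem dz_eq (h : IsPHSubmanifold S ι) (x : M) :
    dz ι x = mfderiv 𝓘(ℝ, Model m) 𝓘(ℝ, EuclideanSpace ℂ (Fin n)) (fun y => (ι y).1) x :=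
  (dvec_fst (h.mdifferentiableAt x)).symm

theorem extD_θ (h : IsPHSubmanifold S ι) (x : M) (v w : TangentSpace 𝓘(ℝ, Model m) x) :
    extD S.θ x v w = 2 * (inner ℂ (dz ι x v) (dz ι x w)).im := by
  have e : S.θ = fun x => (heisΘ (ι x)).comp (mfderiv 𝓘(ℝ, Model m) 𝓘(ℝ, Heis n) ι x) := by
    funext x
    ext v
    exact h.θ_eq x v
  have hd : HasMFDerivAt 𝓘(ℝ, Model m) 𝓘(ℝ, Heis n →L[ℝ] ℝ) (fun x => heisΘ (ι x)) x
      ((heisΘDeriv n).comp (mfderiv 𝓘(ℝ, Model m) 𝓘(ℝ, Heis n) ι x)) :=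
    ((hasFDerivAt_heisΘ (ι x)).hasMFDerivAt).comp x (h.mdifferentiableAt x).hasMFDerivAt
  rw [e, extD_comp_mfderiv hd.mdifferentiableAt ((h.smooth x).of_le two_le_infty), hd.mfderiv]
  change (inner ℂ (dz ι x v) (dz ι x w)).im - (inner ℂ (dz ι x w) (dz ι x v)).im = _
  rw [← inner_conj_symm (dz ι x w), Complex.conj_im]
  ring

theorem dz_J_of_horizontal (h : IsPHSubmanifold S ι) {x : M} {v : TangentSpace 𝓘(ℝ, Model m) x}
    (hv : S.θ x v = 0) : dz ι x (S.J x v) = Complex.I • dz ι x v :=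
  congrArg Prod.fst (h.J_eq x v hv)

/-- Verticality makes ∂/∂t tangent to M. As dθ factors through dz, this vector is the Reeb vector,
which J annihilates. -/
theorem exists_decomposition (h : IsPHSubmanifold S ι) (hv : IsVertical S ι) (x : M) :
    ∃ T : TangentSpace 𝓘(ℝ, Model m) x, dz ι x T = 0 ∧ S.θ x T = 1 ∧ S.J x T = 0 ∧
      ∀ v, S.θ x (v - S.θ x v • T) = 0 := by
  obtain ⟨-, -, T, hT⟩ := hv x
  rw [add_zero] at hT
  have h1 : dz ι x T = 0 := congrArg Prod.fst hT
  have h2 : S.θ x T = 1 := by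
    rw [h.θ_eq, hT, heisΘ_apply]; simp
  refine ⟨T, h1, h2, h.pseudohermitian.J_reeb x T fun w => ?_, fun v => ?_⟩
  · rw [h.extD_θ, h1]; simp
  · rw [map_sub, map_smul, h2]; simp

theorem dz_J (h : IsPHSubmanifold S ι) (hv : IsVertical S ι) (x : M)
    (v : TangentSpace 𝓘(ℝ, Model m) x) : dz ι x (S.J x v) = Complex.I • dz ι x v := by
  obtain ⟨T, h1, h2, h3, h4⟩ := h.exists_decomposition hv x
  have := h.dz_J_of_horizontal (h4 v)
  rwa [map_sub, map_smul, h3, smul_zero, sub_zero, map_sub, map_smul, h1, smul_zero,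
    sub_zero] at this

theorem eq_zero_of_dz_eq_zero (h : IsPHSubmanifold S ι) {x : M}
    {v : TangentSpace 𝓘(ℝ, Model m) x} (hz : dz ι x v = 0) (hθ : S.θ x v = 0) : v = 0 := by
  apply h.immersion x
  have h1 : (push ι x v).1 = 0 := hz
  rw [h.θ_eq, heisΘ_apply, h1, inner_zero_right] at hθ
  rw [map_zero]
  exact Prod.ext h1 (by simpa using hθ)

/-- The right side involves θ and J only: the Hermitian form induced by the immersion is intrinsic.
-/
theorem inner_dz (h : IsPHSubmanifold S ι) (hv : IsVertical S ι) (x : M)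
    (v w : TangentSpace 𝓘(ℝ, Model m) x) :
    inner ℂ (dz ι x v) (dz ι x w) =
      ((extD S.θ x v (S.J x w) / 2 : ℝ) : ℂ) + ((extD S.θ x v w / 2 : ℝ) : ℂ) * Complex.I := by
  rw [h.extD_θ, h.extD_θ, h.dz_J hv, inner_smul_right]
  apply Complex.ext <;> simp

theorem inner_normal_dz (h : IsPHSubmanifold S ι) (hv : IsVertical S ι) {U : Set M}
    {ζ : M → EuclideanSpace ℂ (Fin n)} (hζ : IsNormalOn S ι U ζ) {x : M} (hx : x ∈ U)
    (v : TangentSpace 𝓘(ℝ, Model m) x) : inner ℂ (ζ x) (dz ι x v) = 0 := by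
  obtain ⟨T, h1, h2, h3, h4⟩ := h.exists_decomposition hv x
  have := hζ.2 x hx _ (h4 v)
  rwa [map_sub, map_smul, h1, smul_zero, sub_zero, inner_eq_zero_symm] at this

theorem isJHolomorphicOn (h : IsPHSubmanifold S ι) (hv : IsVertical S ι) (x : M) :
    IsJHolomorphicOn (extChartAt 𝓘(ℝ, Model m) x).target (endoInChart S.J x)
      ((fun y => (ι y).1) ∘ (extChartAt 𝓘(ℝ, Model m) x).symm) where
  isOpen := isOpen_extChartAt_target x
  smooth y hy := (contDiffAt_comp_extChartAt_symm le_rfl hy (h.contMDiffAt_fst _)).contDiffWithinAt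
  smooth_J := h.pseudohermitian.smooth_J x
  fderiv_J y hy v := by
    have hM1 : IsManifold 𝓘(ℝ, Model m) 1 M := isManifold_one
    have hinv := mfderivWithin_extChartAt_symm_comp_mfderiv_extChartAt hy
    rw [ModelWithCorners.range_eq_univ, mfderivWithin_univ] at hinv
    rw [fderiv_comp_extChartAt_symm hy ((h.contMDiffAt_fst _).mdifferentiableAt (by simp)),
      ← h.dz_eq]
    change dz ι _ ((mfderiv 𝓘(ℝ, Model m) 𝓘(ℝ, Model m) (extChartAt 𝓘(ℝ, Model m) x).symm y)
      ((mfderiv 𝓘(ℝ, Model m) 𝓘(ℝ, Model m) (extChartAt 𝓘(ℝ, Model m) x)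
      ((extChartAt 𝓘(ℝ, Model m) x).symm y)) (S.J _ _))) = _
    have e := DFunLike.congr_fun hinv (S.J ((extChartAt 𝓘(ℝ, Model m) x).symm y)
      (mfderiv 𝓘(ℝ, Model m) 𝓘(ℝ, Model m) (extChartAt 𝓘(ℝ, Model m) x).symm y v))
    exact (congrArg (dz ι _) e).trans (h.dz_J hv _ _)

theorem isIsometricPairOn {ι' : M → Heis n} (h : IsPHSubmanifold S ι)
    (hv : IsVertical S ι) (h' : IsPHSubmanifold S ι') (hv' : IsVertical S ι') (x : M) :
    IsIsometricPairOn (extChartAt 𝓘(ℝ, Model m) x).target (endoInChart S.J x)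
      ((fun y => (ι y).1) ∘ (extChartAt 𝓘(ℝ, Model m) x).symm)
      ((fun y => (ι' y).1) ∘ (extChartAt 𝓘(ℝ, Model m) x).symm) where
  left := h.isJHolomorphicOn hv x
  right := h'.isJHolomorphicOn hv' x
  inner_fderiv y hy v w := by
    rw [fderiv_comp_extChartAt_symm hy ((h.contMDiffAt_fst _).mdifferentiableAt (by simp)),
      fderiv_comp_extChartAt_symm hy ((h'.contMDiffAt_fst _).mdifferentiableAt (by simp)),
      ← h.dz_eq, ← h'.dz_eq]
    exact (h.inner_dz hv _ _ _).trans (h'.inner_dz hv' _ _ _).symm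

/-- Differentiate ⟨ζ, dz w⟩ = 0 along v with w constant in the chart. The second fundamental form
thus becomes the normal part of the second derivative of z. -/
theorem inner_normal_fderiv2 (h : IsPHSubmanifold S ι) (hv : IsVertical S ι) {U : Set M}
    (hU : IsOpen U) {ζ : M → EuclideanSpace ℂ (Fin n)} (hζ : IsNormalOn S ι U ζ) {x : M}
    (hx : x ∈ U) (v w : TangentSpace 𝓘(ℝ, Model m) x) :
    inner ℂ (ζ x) (fderiv ℝ (fderiv ℝ ((fun y => (ι y).1) ∘ (extChartAt 𝓘(ℝ, Model m) x).symm))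
      (extChartAt 𝓘(ℝ, Model m) x x) v w) = -inner ℂ (dvec ζ x v) (dz ι x w) := by
  set c := extChartAt 𝓘(ℝ, Model m) x with hc
  have hct : c x ∈ c.target := mem_extChartAt_target x
  have hsx : c.symm (c x) = x := extChartAt_to_inv x
  have hζx : ContMDiffAt 𝓘(ℝ, Model m) 𝓘(ℝ, EuclideanSpace ℂ (Fin n)) ∞ ζ x :=
    hζ.1.contMDiffAt (hU.mem_nhds hx)
  have hζc : HasFDerivAt (ζ ∘ c.symm) (fderiv ℝ (ζ ∘ c.symm) (c x)) (c x) :=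
    hasFDerivAt_of_contDiffAt_infty
      (contDiffAt_comp_extChartAt_symm le_rfl hct (by rw [← hc, hsx]; exact hζx))
  have hzero : ∀ᶠ y in nhds (c x), inner ℂ ((ζ ∘ c.symm) y)
      (fderiv ℝ ((fun y => (ι y).1) ∘ c.symm) y w) =
      inner ℂ (0 : EuclideanSpace ℂ (Fin n)) (0 : EuclideanSpace ℂ (Fin n)) := by
    filter_upwards [eventually_extChartAt_symm (hU.mem_nhds hx), extChartAt_target_mem_nhds x]
      with y hy hy'
    rw [fderiv_comp_extChartAt_symm hy' ((h.contMDiffAt_fst _).mdifferentiableAt (by simp)),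
      ← h.dz_eq, inner_zero_left]
    exact h.inner_normal_dz hv hζ hy _
  have key := inner_add_inner_of_eventuallyEq hzero hζc
    ((h.isJHolomorphicOn hv x).hasFDerivAt_fderiv_apply hct w)
    (hasFDerivAt_const _ _) (hasFDerivAt_const _ _) v
  rw [fderiv_comp_extChartAt_symm_self (hζx.mdifferentiableAt (by simp)),
    fderiv_comp_extChartAt_symm_self ((h.contMDiffAt_fst _).mdifferentiableAt (by simp)),
    ← h.dz_eq] at key
  simp only [Function.comp_apply, hsx, inner_zero_left, inner_zero_right, add_zero] at key
  exact eq_neg_of_add_eq_zero_left key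

/-- This is the symmetry of the second derivative of z, paired with ζ. -/
theorem inner_dvec_dz_comm (h : IsPHSubmanifold S ι) (hv : IsVertical S ι) {U : Set M}
    (hU : IsOpen U) {ζ : M → EuclideanSpace ℂ (Fin n)} (hζ : IsNormalOn S ι U ζ) {x : M}
    (hx : x ∈ U) (v w : TangentSpace 𝓘(ℝ, Model m) x) :
    inner ℂ (dvec ζ x v) (dz ι x w) = inner ℂ (dvec ζ x w) (dz ι x v) := by
  have h1 := h.inner_normal_fderiv2 hv hU hζ hx v w
  have h2 := h.inner_normal_fderiv2 hv hU hζ hx w v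
  have h3 := (h.isJHolomorphicOn hv x).fderiv2_comm (mem_extChartAt_target x) v w
  exact neg_injective (h1.symm.trans ((congrArg (inner ℂ (ζ x)) h3).trans h2))

theorem inner_dvec_J_dz (h : IsPHSubmanifold S ι) (hv : IsVertical S ι) {U : Set M}
    (hU : IsOpen U) {ζ : M → EuclideanSpace ℂ (Fin n)} (hζ : IsNormalOn S ι U ζ) {x : M}
    (hx : x ∈ U) (v w : TangentSpace 𝓘(ℝ, Model m) x) :
    inner ℂ (dvec ζ x (S.J x v)) (dz ι x w) = Complex.I * inner ℂ (dvec ζ x v) (dz ι x w) := by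
  rw [h.inner_dvec_dz_comm hv hU hζ hx, h.dz_J hv, inner_smul_right,
    h.inner_dvec_dz_comm hv hU hζ hx]

/-- The (0,1) projection in `secondForm` changes nothing: by `inner_dvec_J_dz` its two halves
contribute equally. -/
theorem secondForm_eq (h : IsPHSubmanifold S ι) (hv : IsVertical S ι) {U : Set M}
    (hU : IsOpen U) {ζ : M → EuclideanSpace ℂ (Fin n)} (hζ : IsNormalOn S ι U ζ) {x : M}
    (hx : x ∈ U) (X Y : TangentSpace 𝓘(ℝ, Model m) x) :
    secondForm S ι ζ x X Y = -inner ℂ (dvec ζ x Y) (dz ι x X) := by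
  rw [secondForm, inner_smul_left, inner_add_left, inner_smul_left,
    h.inner_dvec_J_dz hv hU hζ hx, Complex.conj_I, ← mul_assoc]
  simp only [map_div₀, map_one, Complex.conj_ofNat, neg_mul, Complex.I_mul_I]
  ring

end IsPHSubmanifold

end Submanifold

/-! ### CR codimension one: the normal line and the span of the jets -/

section Codimension

variable {m : ℕ} {M : Type*} [TopologicalSpace M] [ChartedSpace (Model m) M]
  [IsManifold 𝓘(ℝ, Model m) ∞ M] {S : PHData (Model m) M} {ι : M → Heis (m + 1)}

namespace IsPHSubmanifold

/-- In CR codimension one, normal vectors at a point are proportional. -/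
theorem exists_smul_eq (h : IsPHSubmanifold S ι) (hv : IsVertical S ι) {x : M}
    {a b : EuclideanSpace ℂ (Fin (m + 1))} 
    (ha : ∀ v : TangentSpace 𝓘(ℝ, Model m) x, inner ℂ a (dz ι x v) = 0)
    (hb : ∀ v : TangentSpace 𝓘(ℝ, Model m) x, inner ℂ b (dz ι x v) = 0) (ha0 : a ≠ 0) :
    ∃ c : ℂ, c • a = b := by
  set K : Submodule ℂ (EuclideanSpace ℂ (Fin (m + 1))) :=
    Submodule.span ℂ (Set.range (dz (m := m) ι x)) with hK
  obtain ⟨T, h1, h2, h3, h4⟩ := h.exists_decomposition hv x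
  let A : Model m →ₗ[ℝ] EuclideanSpace ℂ (Fin (m + 1)) := (dz (m := m) ι x).toLinearMap
  obtain ⟨T', hT'⟩ : ∃ T' : Model m, ∀ v : Model m, A v = 0 → ∃ r : ℝ, r • T' = v := by
    refine ⟨T, fun (v : TangentSpace 𝓘(ℝ, Model m) x) hv0 => ⟨S.θ x v, ?_⟩⟩
    have hv0' : dz ι x v = 0 := hv0
    have := h.eq_zero_of_dz_eq_zero (v := v - S.θ x v • T)
      (by rw [map_sub, map_smul, h1, hv0', smul_zero, sub_zero]) (h4 v)
    exact (sub_eq_zero.1 this).symm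
  -- The kernel of dz is at most a line, so dz has real rank at least 2m and its complex span K has
  -- dimension at least m. As a ≠ 0 is orthogonal to K, the complement in ℂ^(m+1) is exactly a line.
  have hker : Module.finrank ℝ A.ker ≤ 1 := by
    have hle : A.ker ≤ Submodule.span ℝ {T'} := fun v hvk =>
      Submodule.mem_span_singleton.2 (hT' v hvk)
    exact (Submodule.finrank_mono hle).trans
      (by simpa using finrank_span_le_card (R := ℝ) ({T'} : Set (Model m)))
  have hrange : 2 * m ≤ Module.finrank ℝ A.range := by
    have := A.finrank_range_add_finrank_ker
    rw [finrank_euclideanSpace, Fintype.card_fin] at this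
    omega
  have hle : A.range ≤ K.restrictScalars ℝ := by
    rintro _ ⟨v, rfl⟩
    exact Submodule.subset_span ⟨v, rfl⟩
  have hK2 : Module.finrank ℝ (K.restrictScalars ℝ) = 2 * Module.finrank ℂ K :=
    finrank_real_of_complex K
  have hKm : m ≤ Module.finrank ℂ K := by
    have := Submodule.finrank_mono hle
    omega
  have hmem : ∀ a : EuclideanSpace ℂ (Fin (m + 1)), 
      (∀ v : TangentSpace 𝓘(ℝ, Model m) x, inner ℂ a (dz ι x v) = 0) → a ∈ Kᗮ := by
    intro a ha
    rw [Submodule.mem_orthogonal']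
    intro u hu
    induction hu using Submodule.span_induction with
    | mem z hz => obtain ⟨v, rfl⟩ := hz; exact ha v
    | zero => exact inner_zero_right a
    | add p q _ _ hp hq => rw [inner_add_right, hp, hq, add_zero]
    | smul c p _ hp => rw [inner_smul_right, hp, mul_zero]
  have hdim : Module.finrank ℂ Kᗮ = 1 := by
    have h5 := K.finrank_add_finrank_orthogonal
    rw [finrank_euclideanSpace, Fintype.card_fin] at h5
    have : 0 < Module.finrank ℂ Kᗮ :=
      Module.finrank_pos_iff_exists_ne_zero.2 ⟨⟨a, hmem a ha⟩, by simpa using ha0⟩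
    omega
  obtain ⟨c, hc⟩ := (finrank_eq_one_iff_of_nonzero' (⟨a, hmem a ha⟩ : Kᗮ) (by simpa using ha0)).1
    hdim ⟨b, hmem b hb⟩
  exact ⟨c, congrArg Subtype.val hc⟩

/-- At a point which is not flat the first two derivatives of the immersion span. -/
theorem span_jetFamily (h : IsPHSubmanifold S ι) (hv : IsVertical S ι) {x : M}
    (hx : ¬ IsFlatPoint S ι x) : ⊤ ≤ Submodule.span ℂ (Set.range (jetFamily
      ((fun y => (ι y).1) ∘ (extChartAt 𝓘(ℝ, Model m) x).symm)
      (extChartAt 𝓘(ℝ, Model m) x x))) := by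
  set c := extChartAt 𝓘(ℝ, Model m) x with hc
  set K := Submodule.span ℂ (Set.range (jetFamily ((fun y => (ι y).1) ∘ c.symm) (c x))) with hK
  -- A nonzero a orthogonal to the jets is normal, so any normal section is a multiple of a at x.
  -- Its second form is its product with second derivatives of z, hence 0, and x would be flat.
  by_contra hne
  have hne' : Kᗮ ≠ ⊥ := fun e => hne (top_le_iff.2 ((Submodule.orthogonal_eq_bot_iff).1 e))
  obtain ⟨a, haK, ha0⟩ := Submodule.exists_mem_ne_zero_of_ne_bot hne'
  rw [Submodule.mem_orthogonal'] at haK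
  have ha1 : ∀ v : TangentSpace 𝓘(ℝ, Model m) x, inner ℂ a (dz ι x v) = 0 := fun v => by
    have := haK _ (Submodule.subset_span ⟨Sum.inl v, rfl⟩)
    simp only [jetFamily] at this
    rwa [fderiv_comp_extChartAt_symm_self ((h.contMDiffAt_fst _).mdifferentiableAt (by simp)),
      ← h.dz_eq] at this
  refine hx fun U hU hxU ζ hζ X Y _ _ => ?_
  obtain ⟨k, hk⟩ := h.exists_smul_eq hv ha1 (h.inner_normal_dz hv hζ hxU) ha0
  rw [h.secondForm_eq hv hU hζ hxU, ← h.inner_normal_fderiv2 hv hU hζ hxU, ← hk, inner_smul_left]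
  have := haK _ (Submodule.subset_span ⟨Sum.inr (Y, X), rfl⟩)
  simp only [jetFamily, Sum.elim_inr] at this
  rw [← hc, this, mul_zero]

end IsPHSubmanifold

end Codimension

/-! ### Unitary maps and left translations as rigid motions -/

section RigidMotion

variable {n : ℕ}

/-- The linear part of `heisMap`. -/
def heisLinear (U : EuclideanSpace ℂ (Fin n) ≃ₗᵢ[ℂ] EuclideanSpace ℂ (Fin n))
    (b : EuclideanSpace ℂ (Fin n)) : Heis n →L[ℝ] Heis n :=
  let U' : EuclideanSpace ℂ (Fin n) →L[ℝ] EuclideanSpace ℂ (Fin n) :=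
    (U.toContinuousLinearEquiv :
      EuclideanSpace ℂ (Fin n) →L[ℂ] EuclideanSpace ℂ (Fin n)).restrictScalars ℝ
  (U'.comp (ContinuousLinearMap.fst ℝ _ ℝ)).prod (ContinuousLinearMap.snd ℝ _ ℝ -
    ((Complex.imCLM.comp (innerR n b)).comp U').comp (ContinuousLinearMap.fst ℝ _ ℝ))

theorem heisLinear_apply (U : EuclideanSpace ℂ (Fin n) ≃ₗᵢ[ℂ] EuclideanSpace ℂ (Fin n))
    (b : EuclideanSpace ℂ (Fin n)) (v : Heis n) :
    heisLinear U b v = (U v.1, v.2 - (inner ℂ b (U v.1)).im) := rfl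

/-- The rigid motion composed of the unitary map `U` and the left translation by `(b, c)`. -/
def heisMap (U : EuclideanSpace ℂ (Fin n) ≃ₗᵢ[ℂ] EuclideanSpace ℂ (Fin n))
    (b : EuclideanSpace ℂ (Fin n)) (c : ℝ) :
    Heis n ≃ₘ^∞⟮𝓘(ℝ, Heis n), 𝓘(ℝ, Heis n)⟯ Heis n where
  toFun p := heisLinear U b p + (b, c)
  -- Solve t' = t - Im⟨b, U z⟩ + c for t, with U z = q.1 - b.
  invFun q := heisLinear U.symm 0 q + (-U.symm b, -c + (inner ℂ b (q.1 - b)).im)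
  left_inv p := by
    refine Prod.ext ?_ ?_ <;> simp [heisLinear_apply]
  right_inv q := by
    refine Prod.ext ?_ ?_ <;> simp [heisLinear_apply, ← sub_eq_add_neg]
    ring
  contMDiff_toFun := ((heisLinear U b).contDiff.add contDiff_const).contMDiff
  contMDiff_invFun := by
    refine ContDiff.contMDiff ?_
    refine (heisLinear U.symm 0).contDiff.add (contDiff_const.prodMk (contDiff_const.add ?_))
    exact (Complex.imCLM.comp (innerR n b)).contDiff.comp (contDiff_fst.sub contDiff_const)

theorem heisMap_apply (U : EuclideanSpace ℂ (Fin n) ≃ₗᵢ[ℂ] EuclideanSpace ℂ (Fin n))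
    (b : EuclideanSpace ℂ (Fin n)) (c : ℝ) (p : Heis n) :
    heisMap U b c p = (U p.1 + b, p.2 - (inner ℂ b (U p.1)).im + c) := rfl

theorem mfderiv_heisMap (U : EuclideanSpace ℂ (Fin n) ≃ₗᵢ[ℂ] EuclideanSpace ℂ (Fin n))
    (b : EuclideanSpace ℂ (Fin n)) (c : ℝ) (p : Heis n) :
    mfderiv 𝓘(ℝ, Heis n) 𝓘(ℝ, Heis n) (heisMap U b c) p = heisLinear U b := by
  rw [mfderiv_eq_fderiv]
  exact ((heisLinear U b).hasFDerivAt.add_const (b, c)).fderiv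

theorem heisΘ_heisLinear (U : EuclideanSpace ℂ (Fin n) ≃ₗᵢ[ℂ] EuclideanSpace ℂ (Fin n))
    (b : EuclideanSpace ℂ (Fin n)) (c : ℝ) (p v : Heis n) :
    heisΘ (heisMap U b c p) (heisLinear U b v) = heisΘ p v := by
  rw [heisΘ_apply, heisΘ_apply, heisLinear_apply, heisMap_apply, inner_add_left,
    U.inner_map_map, Complex.add_im]
  ring

theorem heisLinear_heisJ (U : EuclideanSpace ℂ (Fin n) ≃ₗᵢ[ℂ] EuclideanSpace ℂ (Fin n))
    (b : EuclideanSpace ℂ (Fin n)) (c : ℝ) (p v : Heis n) :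
    heisLinear U b (heisJ p v) = heisJ (heisMap U b c p) (heisLinear U b v) := by
  refine Prod.ext ?_ ?_
  · rw [heisLinear_apply, heisJ_fst, heisJ_fst, heisLinear_apply, map_smul]
  · rw [heisLinear_apply, heisJ_fst, heisJ_snd, heisJ_snd, heisLinear_apply, heisMap_apply]
    simp only
    rw [← map_smul, inner_add_left, U.inner_map_map, Complex.add_im]
    ring

theorem isRigidMotion_heisMap (U : EuclideanSpace ℂ (Fin n) ≃ₗᵢ[ℂ] EuclideanSpace ℂ (Fin n))
    (b : EuclideanSpace ℂ (Fin n)) (c : ℝ) : IsRigidMotion (heisMap U b c) := by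
  refine ⟨fun p v => ?_, fun p v _ => ?_⟩
  · rw [mfderiv_heisMap]
    exact heisΘ_heisLinear U b c p v
  · rw [mfderiv_heisMap]
    exact heisLinear_heisJ U b c p v

end RigidMotion

/-! ### Global congruence of two immersions -/

section Congruence

variable {m : ℕ} {M : Type*} [TopologicalSpace M] [ChartedSpace (Model m) M]

theorem hasMFDerivAt_clm_comp {n : ℕ} {F : Type*} [NormedAddCommGroup F] [NormedSpace ℝ F]
    (L : Heis n →L[ℝ] F) {ι : M → Heis n} {x : M}
    (h : MDifferentiableAt 𝓘(ℝ, Model m) 𝓘(ℝ, Heis n) ι x) :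
    HasMFDerivAt 𝓘(ℝ, Model m) 𝓘(ℝ, F) (fun y => L (ι y)) x (L.comp (push ι x)) :=
  (L.hasMFDerivAt (x := ι x)).comp x h.hasMFDerivAt

variable [IsManifold 𝓘(ℝ, Model m) ∞ M] {S : PHData (Model m) M} {ι ι' : M → Heis (m + 1)}

namespace IsPHSubmanifold

theorem exists_local_isometry (h : IsPHSubmanifold S ι) (hv : IsVertical S ι)
    (h' : IsPHSubmanifold S ι') (hv' : IsVertical S ι') {x : M} (hx : ¬ IsFlatPoint S ι x) :
    ∃ U : EuclideanSpace ℂ (Fin (m + 1)) →ₗᵢ[ℂ] EuclideanSpace ℂ (Fin (m + 1)),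
      ∀ᶠ x' in nhds x, ∀ v : TangentSpace 𝓘(ℝ, Model m) x', dz ι' x' v = U (dz ι x' v) := by
  have hM1 : IsManifold 𝓘(ℝ, Model m) 1 M := isManifold_one
  obtain ⟨U, hU⟩ := (h.isIsometricPairOn hv h' hv' x).exists_isometry
    (mem_extChartAt_target x) (h.span_jetFamily hv hx)
  refine ⟨U, ?_⟩
  filter_upwards [(continuousAt_extChartAt x).eventually hU,
    extChartAt_source_mem_nhds (I := 𝓘(ℝ, Model m)) x] with x' h1 h2 v
  set c := extChartAt 𝓘(ℝ, Model m) x with hc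
  obtain ⟨y, hy, rfl⟩ : ∃ y ∈ c.target, c.symm y = x' := ⟨c x', c.map_source h2, c.left_inv h2⟩
  rw [c.right_inv hy] at h1
  have hinv := mfderivWithin_extChartAt_symm_comp_mfderiv_extChartAt hy
  rw [ModelWithCorners.range_eq_univ, mfderivWithin_univ] at hinv
  have e1 := h1 (mfderiv 𝓘(ℝ, Model m) 𝓘(ℝ, Model m) c (c.symm y) v)
  rw [fderiv_comp_extChartAt_symm hy ((h.contMDiffAt_fst _).mdifferentiableAt (by simp)),
    fderiv_comp_extChartAt_symm hy ((h'.contMDiffAt_fst _).mdifferentiableAt (by simp)),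
    ← h.dz_eq, ← h'.dz_eq] at e1
  have e2 := DFunLike.congr_fun hinv v
  exact (congrArg (dz ι' _) e2).symm.trans (e1.trans (congrArg (fun w => U (dz ι _ w)) e2))

/-- U and U' are constant, so agreement on first derivatives near x passes to second derivatives,
and these jets span. This glues the local isometries. -/
theorem isometry_unique (h : IsPHSubmanifold S ι) (hv : IsVertical S ι) {x : M}
    (hx : ¬ IsFlatPoint S ι x)
    {U U' : EuclideanSpace ℂ (Fin (m + 1)) →ₗᵢ[ℂ] EuclideanSpace ℂ (Fin (m + 1))}
    (hU : ∀ᶠ x' in nhds x, ∀ v : TangentSpace 𝓘(ℝ, Model m) x',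
      U (dz ι x' v) = U' (dz ι x' v)) : U = U' := by
  set c := extChartAt 𝓘(ℝ, Model m) x with hc
  have hct : c x ∈ c.target := mem_extChartAt_target x
  have hJ := h.isJHolomorphicOn hv x
  have h1 : ∀ᶠ y in nhds (c x), ∀ v,
      U (fderiv ℝ ((fun y => (ι y).1) ∘ c.symm) y v) =
        U' (fderiv ℝ ((fun y => (ι y).1) ∘ c.symm) y v) := by
    filter_upwards [eventually_extChartAt_symm hU, extChartAt_target_mem_nhds x] with y hy hy' v
    rw [fderiv_comp_extChartAt_symm hy' ((h.contMDiffAt_fst _).mdifferentiableAt (by simp)),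
      ← h.dz_eq]
    exact hy _
  have h2 : ∀ k, U (jetFamily ((fun y => (ι y).1) ∘ c.symm) (c x) k) =
      U' (jetFamily ((fun y => (ι y).1) ∘ c.symm) (c x) k) := by
    rintro (v | ⟨u, v⟩)
    · exact h1.self_of_nhds v
    · have hd := hJ.hasFDerivAt_fderiv_apply hct v
      have d1 := ((U.toContinuousLinearMap.restrictScalars ℝ).hasFDerivAt).comp (c x) hd
      have d2 := ((U'.toContinuousLinearMap.restrictScalars ℝ).hasFDerivAt).comp (c x) hd
      have d3 := d2.congr_of_eventuallyEq
        (f₁ := (U.toContinuousLinearMap.restrictScalars ℝ) ∘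
          fun z => fderiv ℝ ((fun y => (ι y).1) ∘ c.symm) z v)
        (by filter_upwards [h1] with y hy using hy v)
      exact DFunLike.congr_fun (d1.unique d3) u
  have h3 : U.toLinearMap = U'.toLinearMap :=
    LinearMap.ext_on_range (top_le_iff.1 (h.span_jetFamily hv hx)) h2
  ext1 z
  exact DFunLike.congr_fun h3 z

/-- Two vertical immersions of the same pseudohermitian manifold without flat points are
congruent. -/
theorem exists_congruence [PreconnectedSpace M] [Nonempty M] (h : IsPHSubmanifold S ι)
    (hv : IsVertical S ι) (hf : ∀ x, ¬ IsFlatPoint S ι x)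
    (h' : IsPHSubmanifold S ι') (hv' : IsVertical S ι') :
    ∃ (U : EuclideanSpace ℂ (Fin (m + 1)) ≃ₗᵢ[ℂ] EuclideanSpace ℂ (Fin (m + 1)))
      (b : EuclideanSpace ℂ (Fin (m + 1))) (c : ℝ), ∀ x, ι' x = heisMap U b c (ι x) := by
  choose U hU using fun x => h.exists_local_isometry hv h' hv' (hf x)
  -- U x was chosen point by point; near x both U x and U x' carry dz ι to dz ι' around x', so
  -- uniqueness identifies them.
  have hconst : IsLocallyConstant U := by
    rw [IsLocallyConstant.iff_eventually_eq]
    intro x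
    filter_upwards [(hU x).eventually_nhds] with x' hx'
    refine h.isometry_unique hv (hf x') ?_
    filter_upwards [hU x', hx'] with x'' h1 h2 v
    rw [← h1, ← h2]
  obtain ⟨x₀⟩ := ‹Nonempty M›
  let V : EuclideanSpace ℂ (Fin (m + 1)) ≃ₗᵢ[ℂ] EuclideanSpace ℂ (Fin (m + 1)) :=
    (U x₀).toLinearIsometryEquiv rfl
  have hV : ∀ x, ∀ v : TangentSpace 𝓘(ℝ, Model m) x, dz ι' x v = V (dz ι x v) := fun x v => by
    have := (hU x).self_of_nhds v
    rw [hconst.apply_eq_of_preconnectedSpace x x₀] at this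
    exact this
  have hz : ∀ x, (ι' x).1 - V (ι x).1 = (ι' x₀).1 - V (ι x₀).1 := by
    have hd : ∀ x, HasMFDerivAt 𝓘(ℝ, Model m) 𝓘(ℝ, EuclideanSpace ℂ (Fin (m + 1)))
        (fun x => (ι' x).1 - V (ι x).1) x
        (0 : TangentSpace 𝓘(ℝ, Model m) x →L[ℝ] EuclideanSpace ℂ (Fin (m + 1))) := fun x => by
      have h1 := hasMFDerivAt_clm_comp (ContinuousLinearMap.fst ℝ _ ℝ) (h'.mdifferentiableAt x)
      have h2 := hasMFDerivAt_clm_comp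
        ((ContinuousLinearMap.fst ℝ (EuclideanSpace ℂ (Fin (m + 1))) ℝ).comp (heisLinear V 0))
        (h.mdifferentiableAt x)
      refine (h1.sub h2).congr_mfderiv ?_
      ext1 v
      exact sub_eq_zero.2 (hV x v)
    exact fun x => eq_of_mfderiv_eq_zero (fun x => (hd x).mdifferentiableAt)
      (fun x => (hd x).mfderiv) x x₀
  set b := (ι' x₀).1 - V (ι x₀).1 with hb
  have hzb : ∀ x, (ι' x).1 = V (ι x).1 + b := fun x => by rw [← hz x]; abel
  -- The two contact forms agree: dt' + Im⟨z', dz'⟩ = dt + Im⟨z, dz⟩. With z' = V z + b this leaves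
  -- dt' = dt - Im⟨b, V dz⟩, the last component of `heisLinear V b`.
  have ht : ∀ x, (ι' x).2 - (heisLinear V b (ι x)).2 = (ι' x₀).2 - (heisLinear V b (ι x₀)).2 := by
    have hd : ∀ x, HasMFDerivAt 𝓘(ℝ, Model m) 𝓘(ℝ, ℝ)
        (fun x => (ι' x).2 - (heisLinear V b (ι x)).2) x
        (0 : TangentSpace 𝓘(ℝ, Model m) x →L[ℝ] ℝ) := fun x => by
      have h1 := hasMFDerivAt_clm_comp
        (ContinuousLinearMap.snd ℝ (EuclideanSpace ℂ (Fin (m + 1))) ℝ) (h'.mdifferentiableAt x)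
      have h2 := hasMFDerivAt_clm_comp
        ((ContinuousLinearMap.snd ℝ (EuclideanSpace ℂ (Fin (m + 1))) ℝ).comp (heisLinear V b))
        (h.mdifferentiableAt x)
      refine (h1.sub h2).congr_mfderiv ?_
      ext1 v
      change (push ι' x v).2 - ((push ι x v).2 - (inner ℂ b (V (dz ι x v))).im) = (0 : ℝ)
      have e1 := h.θ_eq x v
      have e2 := h'.θ_eq x v
      rw [heisΘ_apply] at e1 e2
      change _ = _ + (inner ℂ (ι x).1 (dz ι x v)).im at e1
      change _ = _ + (inner ℂ (ι' x).1 (dz ι' x v)).im at e2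
      rw [hV, hzb, inner_add_left, V.inner_map_map, Complex.add_im] at e2
      linarith
    exact fun x => eq_of_mfderiv_eq_zero (fun x => (hd x).mdifferentiableAt)
      (fun x => (hd x).mfderiv) x x₀
  refine ⟨V, b, (ι' x₀).2 - (heisLinear V b (ι x₀)).2, fun x => Prod.ext (hzb x) ?_⟩
  rw [← ht x]
  change _ = (heisLinear V b (ι x)).2 + ((ι' x).2 - (heisLinear V b (ι x)).2)
  ring

end IsPHSubmanifold

end Congruence

/-! ### Pseudohermitian transformations and composed immersions -/

section Transformation

variable {m n : ℕ} {M : Type*} [TopologicalSpace M] [ChartedSpace (Model m) M]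
  {N : Type*} [TopologicalSpace N] [ChartedSpace (Model m) N]
  {SM : PHData (Model m) M} {SN : PHData (Model m) N}
  {φ : M ≃ₘ^∞⟮𝓘(ℝ, Model m), 𝓘(ℝ, Model m)⟯ N}

theorem mdifferentiableAt_diffeomorph (φ : M ≃ₘ^∞⟮𝓘(ℝ, Model m), 𝓘(ℝ, Model m)⟯ N) (x : M) :
    MDifferentiableAt 𝓘(ℝ, Model m) 𝓘(ℝ, Model m) φ x :=
  φ.contMDiff.contMDiffAt.mdifferentiableAt (by simp)

theorem mfderiv_diffeomorph_bijective (φ : M ≃ₘ^∞⟮𝓘(ℝ, Model m), 𝓘(ℝ, Model m)⟯ N) (x : M) :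
    Function.Bijective (mfderiv 𝓘(ℝ, Model m) 𝓘(ℝ, Model m) φ x) :=
  (φ.mfderivToContinuousLinearEquiv (by simp) x).bijective

theorem push_comp {ι : N → Heis n} {x : M}
    (h : MDifferentiableAt 𝓘(ℝ, Model m) 𝓘(ℝ, Heis n) ι (φ x))
    (v : TangentSpace 𝓘(ℝ, Model m) x) :
    push (fun y => ι (φ y)) x v =
      push ι (φ x) (mfderiv 𝓘(ℝ, Model m) 𝓘(ℝ, Model m) φ x v) :=
  DFunLike.congr_fun (mfderiv_comp x h (mdifferentiableAt_diffeomorph φ x)) v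

variable [IsManifold 𝓘(ℝ, Model m) ∞ N]

variable [IsManifold 𝓘(ℝ, Model m) ∞ M] in
theorem IsPHSubmanifold.comp_diffeomorph {ι : N → Heis n} (h : IsPHSubmanifold SN ι)
    (hM : SM.IsPseudohermitian m) (hφ : IsPHTransformation SM SN φ) :
    IsPHSubmanifold SM (fun x => ι (φ x)) where
  pseudohermitian := hM
  smooth := h.smooth.comp φ.contMDiff
  immersion x v w hvw := by
    rw [push_comp (h.mdifferentiableAt _), push_comp (h.mdifferentiableAt _)] at hvw
    exact (mfderiv_diffeomorph_bijective φ x).1 (h.immersion _ hvw)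
  θ_eq x v := by
    rw [push_comp (h.mdifferentiableAt _), ← h.θ_eq, hφ.1]
  J_eq x v hv := by
    rw [push_comp (h.mdifferentiableAt _), push_comp (h.mdifferentiableAt _), hφ.2 x v hv,
      h.J_eq _ _ (by rw [hφ.1, hv])]

theorem IsVertical.comp_diffeomorph {ι : N → Heis n} (h : IsPHSubmanifold SN ι)
    (hv : IsVertical SN ι) : IsVertical SM (fun x => ι (φ x)) := by
  intro x
  obtain ⟨h1, -, T, hT⟩ := hv (φ x)
  obtain ⟨T', rfl⟩ := (mfderiv_diffeomorph_bijective φ x).2 T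
  exact ⟨h1, fun v _ => by simp, T', by rw [push_comp (h.mdifferentiableAt _), hT]⟩

variable [IsManifold 𝓘(ℝ, Model m) ∞ M] in
/-- A diffeomorphism which extends to a rigid motion is a pseudohermitian transformation. -/
theorem isPHTransformation_of_isRigidMotion {ιM : M → Heis n} {ιN : N → Heis n}
    (hM : IsPHSubmanifold SM ιM) (hN : IsPHSubmanifold SN ιN)
    {Φ : Heis n ≃ₘ^∞⟮𝓘(ℝ, Heis n), 𝓘(ℝ, Heis n)⟯ Heis n} (hΦ : IsRigidMotion Φ)
    (h : ∀ x, ιN (φ x) = Φ (ιM x)) : IsPHTransformation SM SN φ := by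
  have hpush : ∀ x (v : TangentSpace 𝓘(ℝ, Model m) x),
      push ιN (φ x) (mfderiv 𝓘(ℝ, Model m) 𝓘(ℝ, Model m) φ x v) =
        mfderiv 𝓘(ℝ, Heis n) 𝓘(ℝ, Heis n) Φ (ιM x) (push ιM x v) := fun x v => by
    rw [← push_comp (hN.mdifferentiableAt _)]
    have e : (fun y => ιN (φ y)) = Φ ∘ ιM := funext h
    rw [e]
    exact DFunLike.congr_fun (mfderiv_comp x
      (Φ.contMDiff.contMDiffAt.mdifferentiableAt (by simp)) (hM.mdifferentiableAt x)) v
  have hθ : ∀ x v, SN.θ (φ x) (mfderiv 𝓘(ℝ, Model m) 𝓘(ℝ, Model m) φ x v) = SM.θ x v :=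
    fun x v => by
      rw [hN.θ_eq, hpush, h, hM.θ_eq]
      exact hΦ.1 (ιM x) (push ιM x v)
  -- The differential of ιN is injective, so J may be compared after pushing forward to the
  -- Heisenberg group.
  refine ⟨hθ, fun x v hv => hN.immersion (φ x) ?_⟩
  rw [hpush, hM.J_eq x v hv, hN.J_eq _ _ (by rw [hθ, hv]), hpush, h]
  exact hΦ.2 (ιM x) (push ιM x v) (by rw [hM.θ_eq] at hv; exact hv)

end Transformation

/-! ### Transport of Darboux frames -/

section Transport

variable {m : ℕ} {M : Type*} [TopologicalSpace M] [ChartedSpace (Model m) M]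
  {N : Type*} [TopologicalSpace N] [ChartedSpace (Model m) N]
  {SM : PHData (Model m) M} {SN : PHData (Model m) N}
  {φ : M ≃ₘ^∞⟮𝓘(ℝ, Model m), 𝓘(ℝ, Model m)⟯ N}
  {ιM : M → Heis (m + 1)} {ιN : N → Heis (m + 1)}

/-- The composite of a map with an isometry and the inverse of a diffeomorphism. -/
def transport (φ : M ≃ₘ^∞⟮𝓘(ℝ, Model m), 𝓘(ℝ, Model m)⟯ N)
    (U : EuclideanSpace ℂ (Fin (m + 1)) ≃ₗᵢ[ℂ] EuclideanSpace ℂ (Fin (m + 1)))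
    (ζ : M → EuclideanSpace ℂ (Fin (m + 1))) (y : N) : EuclideanSpace ℂ (Fin (m + 1)) :=
  U (ζ (φ.symm y))

theorem transport_apply (U : EuclideanSpace ℂ (Fin (m + 1)) ≃ₗᵢ[ℂ] EuclideanSpace ℂ (Fin (m + 1)))
    (ζ : M → EuclideanSpace ℂ (Fin (m + 1))) (x : M) :
    transport φ U ζ (φ x) = U (ζ x) := by
  simp [transport]

theorem contMDiffOn_transport
    (U : EuclideanSpace ℂ (Fin (m + 1)) ≃ₗᵢ[ℂ] EuclideanSpace ℂ (Fin (m + 1)))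
    {ζ : M → EuclideanSpace ℂ (Fin (m + 1))} {s : Set M}
    (hζ : ContMDiffOn 𝓘(ℝ, Model m) 𝓘(ℝ, EuclideanSpace ℂ (Fin (m + 1))) ∞ ζ s) :
    ContMDiffOn 𝓘(ℝ, Model m) 𝓘(ℝ, EuclideanSpace ℂ (Fin (m + 1))) ∞ (transport φ U ζ)
      (φ '' s) := by
  have hU : ContMDiff 𝓘(ℝ, EuclideanSpace ℂ (Fin (m + 1))) 𝓘(ℝ, EuclideanSpace ℂ (Fin (m + 1))) ∞
      U := ((U.toContinuousLinearEquiv : EuclideanSpace ℂ (Fin (m + 1)) →L[ℂ]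
        EuclideanSpace ℂ (Fin (m + 1))).restrictScalars ℝ).contMDiff
  refine hU.comp_contMDiffOn (hζ.comp φ.symm.contMDiff.contMDiffOn ?_)
  rintro _ ⟨x, hx, rfl⟩
  simpa using hx

theorem dvec_transport (U : EuclideanSpace ℂ (Fin (m + 1)) ≃ₗᵢ[ℂ] EuclideanSpace ℂ (Fin (m + 1)))
    {ζ : M → EuclideanSpace ℂ (Fin (m + 1))} {s : Set M} (hs : IsOpen s)
    (hζ : ContMDiffOn 𝓘(ℝ, Model m) 𝓘(ℝ, EuclideanSpace ℂ (Fin (m + 1))) ∞ ζ s) {x : M}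
    (hx : x ∈ s) (v : TangentSpace 𝓘(ℝ, Model m) x) :
    dvec (transport φ U ζ) (φ x) (mfderiv 𝓘(ℝ, Model m) 𝓘(ℝ, Model m) φ x v) =
      U (dvec ζ x v) := by
  have hs' : IsOpen (φ '' s) := φ.toHomeomorph.isOpenMap s hs
  have h1 := (contMDiffOn_transport (φ := φ) U hζ).contMDiffAt
    (hs'.mem_nhds (Set.mem_image_of_mem φ hx))
  have h2 := (hζ.contMDiffAt (hs.mem_nhds hx)).mdifferentiableAt (by simp)
  have e1 := mfderiv_comp x (h1.mdifferentiableAt (by simp)) (mdifferentiableAt_diffeomorph φ x)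
  have e2 : transport φ U ζ ∘ φ = fun y => U (ζ y) := funext fun y => transport_apply U ζ y
  have e3 : HasMFDerivAt 𝓘(ℝ, Model m) 𝓘(ℝ, EuclideanSpace ℂ (Fin (m + 1))) (fun y => U (ζ y)) x
      (((U.toContinuousLinearEquiv : EuclideanSpace ℂ (Fin (m + 1)) →L[ℂ]
        EuclideanSpace ℂ (Fin (m + 1))).restrictScalars ℝ).comp (dvec ζ x)) :=
    (((U.toContinuousLinearEquiv : EuclideanSpace ℂ (Fin (m + 1)) →L[ℂ]
        EuclideanSpace ℂ (Fin (m + 1))).restrictScalars ℝ).hasMFDerivAt (x := ζ x)).comp x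
      h2.hasMFDerivAt
  rw [e2, e3.mfderiv] at e1
  exact (DFunLike.congr_fun e1 v).symm

/-- The frame `φ_* e`. -/
def pushFrame (φ : M ≃ₘ^∞⟮𝓘(ℝ, Model m), 𝓘(ℝ, Model m)⟯ N)
    (e : ∀ x : M, TangentSpace 𝓘(ℝ, Model m) x) (y : N) : TangentSpace 𝓘(ℝ, Model m) y :=
  (mfderiv 𝓘(ℝ, Model m) 𝓘(ℝ, Model m) φ (φ.symm y) (e (φ.symm y)) : Model m)

theorem pushFrame_apply (e : ∀ x : M, TangentSpace 𝓘(ℝ, Model m) x) (x : M) :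
    pushFrame φ e (φ x) = mfderiv 𝓘(ℝ, Model m) 𝓘(ℝ, Model m) φ x (e x) := by
  -- The tangent space depends on the base point; generalizing over x' avoids a dependent rewrite
  -- along `φ.symm (φ x) = x`.
  have : ∀ x', x' = x → (mfderiv 𝓘(ℝ, Model m) 𝓘(ℝ, Model m) φ x' (e x') : Model m) =
      (mfderiv 𝓘(ℝ, Model m) 𝓘(ℝ, Model m) φ x (e x) : Model m) := by
    rintro _ rfl; rfl
  exact this _ (φ.symm_apply_apply x)

variable [IsManifold 𝓘(ℝ, Model m) ∞ M] [IsManifold 𝓘(ℝ, Model m) ∞ N]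

/-- A pseudohermitian transformation which extends to a rigid motion preserves Darboux frames, the
second fundamental form and the normal connection. -/
theorem exists_transported_frame (hN : IsPHSubmanifold SN ιN)
    (hM : IsPHSubmanifold SM ιM) (hφ : IsPHTransformation SM SN φ)
    {V : EuclideanSpace ℂ (Fin (m + 1)) ≃ₗᵢ[ℂ] EuclideanSpace ℂ (Fin (m + 1))}
    {b : EuclideanSpace ℂ (Fin (m + 1))} {c : ℝ} (h : ∀ x, ιN (φ x) = heisMap V b c (ιM x))
    {U : Set M} {e : Fin m → ∀ x : M, TangentSpace 𝓘(ℝ, Model m) x}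
    {ζ : M → EuclideanSpace ℂ (Fin (m + 1))} (hU : IsOpen U) (he : IsDarbouxFrame SM ιM U e ζ) :
    ∃ (e' : Fin m → ∀ y : N, TangentSpace 𝓘(ℝ, Model m) y)
      (ζ' : N → EuclideanSpace ℂ (Fin (m + 1))), IsDarbouxFrame SN ιN (φ '' U) e' ζ' ∧
      (∀ x ∈ U, ∀ j, e' j (φ x) = mfderiv 𝓘(ℝ, Model m) 𝓘(ℝ, Model m) φ x (e j x)) ∧
      (∀ x ∈ U, ∀ j k, secondCoeff SN ιN e' ζ' (φ x) j k = secondCoeff SM ιM e ζ x j k) ∧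
      (∀ x ∈ U, ∀ v, normalForm ζ' (φ x) (mfderiv 𝓘(ℝ, Model m) 𝓘(ℝ, Model m) φ x v) =
        normalForm ζ x v) := by
  -- dz changes by the constant unitary map V, so moving the frame and the normal by V preserves all
  -- Hermitian products of their derivatives.
  have hdz : ∀ x (v : TangentSpace 𝓘(ℝ, Model m) x),
      dz ιN (φ x) (mfderiv 𝓘(ℝ, Model m) 𝓘(ℝ, Model m) φ x v) = V (dz ιM x v) := fun x v => by
    have e1 := push_comp (hN.mdifferentiableAt (φ x)) v
    have e2 : (fun y => ιN (φ y)) = heisMap V b c ∘ ιM := funext h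
    have e3 := mfderiv_comp x
      ((heisMap V b c).contMDiff.contMDiffAt.mdifferentiableAt (by simp)) (hM.mdifferentiableAt x)
    rw [mfderiv_heisMap] at e3
    rw [e2] at e1
    exact congrArg Prod.fst (e1.symm.trans (DFunLike.congr_fun e3 v))
  have hfr : ∀ j x, dz ιN (φ x) (pushFrame φ (e j) (φ x)) = V (dz ιM x (e j x)) := fun j x => by
    rw [pushFrame_apply, hdz]
  refine ⟨fun j => pushFrame φ (e j), transport φ V ζ, ⟨?_, ?_, ?_, ⟨?_, ?_⟩, ?_⟩, ?_, ?_, ?_⟩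
  · rintro _ ⟨x, hx, rfl⟩ j
    rw [pushFrame_apply, hφ.1, he.horizontal x hx]
  · intro j
    refine (contMDiffOn_transport (φ := φ) V (he.smooth j)).congr ?_
    rintro _ ⟨x, hx, rfl⟩
    rw [hfr, transport_apply]
  · rintro _ ⟨x, hx, rfl⟩
    simp only [hfr]
    exact (he.orthonormal x hx).comp_linearIsometry V.toLinearIsometry
  · exact contMDiffOn_transport V he.normal.1
  · rintro _ ⟨x, hx, rfl⟩ v hv
    obtain ⟨v, rfl⟩ := (mfderiv_diffeomorph_bijective φ x).2 v
    rw [hφ.1] at hv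
    rw [hdz, transport_apply, V.inner_map_map]
    exact he.normal.2 x hx v hv
  · rintro _ ⟨x, hx, rfl⟩
    rw [transport_apply, V.norm_map]
    exact he.unit x hx
  · exact fun x _ j => pushFrame_apply (e j) x
  · intro x hx j k
    rw [secondCoeff, secondCoeff, secondForm, secondForm, hfr, pushFrame_apply,
      ← hφ.2 x _ (he.horizontal x hx k), dvec_transport V hU he.normal.1 hx,
      dvec_transport V hU he.normal.1 hx, ← map_smul, ← map_add, ← map_smul, V.inner_map_map]
  · intro x hx v
    change inner ℂ (transport φ V ζ (φ x)) (dvec (transport φ V ζ) (φ x) _) =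
      inner ℂ (ζ x) (dvec ζ x v)
    rw [transport_apply, dvec_transport V hU he.normal.1 hx, V.inner_map_map]

end Transport

/-! ### Parseval's identity and connection forms -/

section Frames

variable {m : ℕ}

/-- Parseval's identity for an orthonormal family completed by a unit normal. -/
theorem inner_eq_sum_add {Z : Fin m → EuclideanSpace ℂ (Fin (m + 1))}
    {ζ : EuclideanSpace ℂ (Fin (m + 1))} (hZ : Orthonormal ℂ Z) (hζ : ‖ζ‖ = 1)
    (hζZ : ∀ j, inner ℂ ζ (Z j) = 0) (a b : EuclideanSpace ℂ (Fin (m + 1))) :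
    inner ℂ a b = (∑ k, inner ℂ a (Z k) * inner ℂ (Z k) b) + inner ℂ a ζ * inner ℂ ζ b := by
  let F : Option (Fin m) → EuclideanSpace ℂ (Fin (m + 1)) := fun o => o.elim ζ Z
  have hF : Orthonormal ℂ F := by
    rw [orthonormal_iff_ite] at hZ ⊢
    rintro (_ | j) (_ | k)
    · simp [F, inner_self_eq_norm_sq_to_K, hζ]
    · simpa [F] using hζZ k
    · simpa [F] using inner_eq_zero_symm.1 (hζZ j)
    · simpa [F] using hZ j k
  have hsp : ⊤ ≤ Submodule.span ℂ (Set.range F) :=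
    (hF.linearIndependent.span_eq_top_of_card_eq_finrank' (by simp)).ge
  have := (OrthonormalBasis.mk hF hsp).sum_inner_mul_inner a b
  rw [← this, Fintype.sum_option, add_comm]
  simp [F]

variable {n : ℕ} {M : Type*} [TopologicalSpace M] [ChartedSpace (Model m) M]

theorem connForm_apply (Z W : M → EuclideanSpace ℂ (Fin n)) (x : M)
    (v : TangentSpace 𝓘(ℝ, Model m) x) : connForm Z W x v = inner ℂ (W x) (dvec Z x v) := rfl

theorem inner_dvec_add_inner_dvec {a b : M → EuclideanSpace ℂ (Fin n)} {x : M}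
    (ha : MDifferentiableAt 𝓘(ℝ, Model m) 𝓘(ℝ, EuclideanSpace ℂ (Fin n)) a x)
    (hb : MDifferentiableAt 𝓘(ℝ, Model m) 𝓘(ℝ, EuclideanSpace ℂ (Fin n)) b x)
    (h : ∀ᶠ y in nhds x, inner ℂ (a y) (b y) = inner ℂ (a x) (b x))
    (v : TangentSpace 𝓘(ℝ, Model m) x) :
    inner ℂ (a x) (dvec b x v) + inner ℂ (dvec a x v) (b x) = 0 := by
  let B : EuclideanSpace ℂ (Fin n) × EuclideanSpace ℂ (Fin n) → ℂ := fun p => inner ℂ p.1 p.2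
  have hB : HasFDerivAt B (fderivInnerCLM ℂ (a x, b x)) (a x, b x) :=
    isBoundedBilinearMap_inner.hasFDerivAt (a x, b x)
  have hab : HasMFDerivAt 𝓘(ℝ, Model m)
      𝓘(ℝ, EuclideanSpace ℂ (Fin n) × EuclideanSpace ℂ (Fin n)) (fun y => (a y, b y)) x
      ((dvec a x).prod (dvec b x)) :=
    ⟨ha.continuousAt.prodMk hb.continuousAt, ha.hasMFDerivAt.2.prodMk hb.hasMFDerivAt.2⟩
  have h1 : HasMFDerivAt 𝓘(ℝ, Model m) 𝓘(ℝ, ℂ) (fun y => B (a y, b y)) x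
      ((fderivInnerCLM ℂ (a x, b x)).comp ((dvec a x).prod (dvec b x))) :=
    HasMFDerivAt.comp x (g := B) (f := fun y => (a y, b y)) hB.hasMFDerivAt hab
  have h2 : HasMFDerivAt 𝓘(ℝ, Model m) 𝓘(ℝ, ℂ) (fun y => B (a y, b y)) x
      (0 : TangentSpace 𝓘(ℝ, Model m) x →L[ℝ] ℂ) :=
    (hasMFDerivAt_const (inner ℂ (a x) (b x)) x).congr_of_eventuallyEq h
  exact DFunLike.congr_fun (hasMFDerivAt_unique h1 h2) v

variable [IsManifold 𝓘(ℝ, Model m) ∞ M]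

theorem extD_connForm {Z W : M → EuclideanSpace ℂ (Fin n)} {x : M}
    (hZ : ContMDiffAt 𝓘(ℝ, Model m) 𝓘(ℝ, EuclideanSpace ℂ (Fin n)) ∞ Z x)
    (hW : ContMDiffAt 𝓘(ℝ, Model m) 𝓘(ℝ, EuclideanSpace ℂ (Fin n)) ∞ W x)
    (v w : TangentSpace 𝓘(ℝ, Model m) x) :
    extD (connForm Z W) x v w =
      inner ℂ (dvec W x v) (dvec Z x w) - inner ℂ (dvec W x w) (dvec Z x v) := by
  have hd : HasMFDerivAt 𝓘(ℝ, Model m) 𝓘(ℝ, EuclideanSpace ℂ (Fin n) →L[ℝ] ℂ)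
      (fun y => innerR n (W y)) x ((innerR n).comp (dvec W x)) :=
    ((innerR n).hasMFDerivAt (x := W x)).comp x (hW.mdifferentiableAt (by simp)).hasMFDerivAt
  have := extD_comp_mfderiv hd.mdifferentiableAt (hZ.of_le two_le_infty) v w
  rw [hd.mfderiv] at this
  exact this

theorem smoothFormOn_connForm {Z W : M → EuclideanSpace ℂ (Fin n)} {U : Set M} (hU : IsOpen U)
    (hZ : ContMDiffOn 𝓘(ℝ, Model m) 𝓘(ℝ, EuclideanSpace ℂ (Fin n)) ∞ Z U)
    (hW : ContMDiffOn 𝓘(ℝ, Model m) 𝓘(ℝ, EuclideanSpace ℂ (Fin n)) ∞ W U) :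
    SmoothFormOn (connForm (m := m) Z W) U :=
  smoothFormOn_comp_mfderiv (a := fun y => innerR n (W y)) hU
    ((innerR n).contMDiff.comp_contMDiffOn hW) hZ

end Frames

/-! ### Darboux frames: Webster connection, Gauss and Codazzi equations -/

section Darboux

variable {m : ℕ} {M : Type*} [TopologicalSpace M] [ChartedSpace (Model m) M]
  {S : PHData (Model m) M} {ι : M → Heis (m + 1)} {U : Set M}
  {e : Fin m → ∀ x : M, TangentSpace 𝓘(ℝ, Model m) x} {ζ : M → EuclideanSpace ℂ (Fin (m + 1))}

/-- The vectors `Z_j` of a frame, as maps to `ℂⁿ`. -/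
def frameVec (ι : M → Heis (m + 1)) (e : Fin m → ∀ x : M, TangentSpace 𝓘(ℝ, Model m) x)
    (j : Fin m) (x : M) : EuclideanSpace ℂ (Fin (m + 1)) := dz ι x (e j x)

/-- The coframe dual to a Darboux frame. -/
def frameCoform (ι : M → Heis (m + 1)) (e : Fin m → ∀ x : M, TangentSpace 𝓘(ℝ, Model m) x)
    (j : Fin m) (x : M) : TangentSpace 𝓘(ℝ, Model m) x →L[ℝ] ℂ :=
  connForm (fun y => (ι y).1) (frameVec ι e j) x

/-- The tangential connection forms of a Darboux frame. -/
def frameConn (ι : M → Heis (m + 1)) (e : Fin m → ∀ x : M, TangentSpace 𝓘(ℝ, Model m) x)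
    (j k : Fin m) (x : M) : TangentSpace 𝓘(ℝ, Model m) x →L[ℝ] ℂ :=
  connForm (frameVec ι e j) (frameVec ι e k) x

namespace IsDarbouxFrame

variable {x : M}

theorem contMDiffAt_frameVec (he : IsDarbouxFrame S ι U e ζ) (hU : IsOpen U) (hx : x ∈ U)
    (j : Fin m) : ContMDiffAt 𝓘(ℝ, Model m) 𝓘(ℝ, EuclideanSpace ℂ (Fin (m + 1))) ∞
      (frameVec ι e j) x :=
  (he.smooth j).contMDiffAt (hU.mem_nhds hx)

theorem contMDiffAt_normal (he : IsDarbouxFrame S ι U e ζ) (hU : IsOpen U) (hx : x ∈ U) :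
    ContMDiffAt 𝓘(ℝ, Model m) 𝓘(ℝ, EuclideanSpace ℂ (Fin (m + 1))) ∞ ζ x :=
  he.normal.1.contMDiffAt (hU.mem_nhds hx)

theorem inner_normal_frameVec (he : IsDarbouxFrame S ι U e ζ) (hx : x ∈ U) (j : Fin m) :
    inner ℂ (ζ x) (frameVec ι e j x) = 0 :=
  inner_eq_zero_symm.1 (he.normal.2 x hx _ (he.horizontal x hx j))

theorem inner_frameVec (he : IsDarbouxFrame S ι U e ζ) (hx : x ∈ U) (j k : Fin m) :
    inner ℂ (frameVec ι e j x) (frameVec ι e k x) = if j = k then 1 else 0 :=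
  orthonormal_iff_ite.1 (he.orthonormal x hx) j k

theorem inner_eq (he : IsDarbouxFrame S ι U e ζ) (hx : x ∈ U)
    (a b : EuclideanSpace ℂ (Fin (m + 1))) :
    inner ℂ a b = (∑ k, inner ℂ a (frameVec ι e k x) * inner ℂ (frameVec ι e k x) b) +
      inner ℂ a (ζ x) * inner ℂ (ζ x) b :=
  inner_eq_sum_add (he.orthonormal x hx) (he.unit x hx) (he.inner_normal_frameVec hx) a b

theorem inner_dvec_frameVec_normal (x : M) (j : Fin m) (v : TangentSpace 𝓘(ℝ, Model m) x) :
    inner ℂ (dvec (frameVec ι e j) x v) (ζ x) = (starRingEnd ℂ) (mixedForm ι e ζ j x v) :=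
  (inner_conj_symm _ _).symm

theorem websterCurvature_congr
    {Γ Γ' : Fin m → Fin m → ∀ x : M, TangentSpace 𝓘(ℝ, Model m) x →L[ℝ] ℂ}
    (hU : IsOpen U) (hΓ : ∀ y ∈ U, ∀ j k, Γ j k y = Γ' j k y) (hx : x ∈ U) :
    websterCurvature S e Γ x = websterCurvature S e Γ' x := by
  have h1 : ∀ j k, extD (Γ j k) x = extD (Γ' j k) x := fun j k => extD_congr (by
    filter_upwards [hU.mem_nhds hx] with y hy using hΓ y hy j k)
  funext j l p q
  simp only [websterCurvature, h1, hΓ x hx]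

theorem inner_dvec_frameVec (he : IsDarbouxFrame S ι U e ζ) (hU : IsOpen U) (hx : x ∈ U)
    (j k : Fin m) (v : TangentSpace 𝓘(ℝ, Model m) x) :
    inner ℂ (dvec (frameVec ι e j) x v) (frameVec ι e k x) = -frameConn ι e k j x v := by
  have := inner_dvec_add_inner_dvec
    ((he.contMDiffAt_frameVec hU hx j).mdifferentiableAt (by simp))
    ((he.contMDiffAt_frameVec hU hx k).mdifferentiableAt (by simp)) (by
      filter_upwards [hU.mem_nhds hx] with y hy
      rw [he.inner_frameVec hy, he.inner_frameVec hx]) v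
  exact eq_neg_of_add_eq_zero_right this

theorem inner_dvec_normal_frameVec (he : IsDarbouxFrame S ι U e ζ) (hU : IsOpen U) (hx : x ∈ U)
    (j : Fin m) (v : TangentSpace 𝓘(ℝ, Model m) x) :
    inner ℂ (dvec ζ x v) (frameVec ι e j x) = -mixedForm ι e ζ j x v := by
  have := inner_dvec_add_inner_dvec
    ((he.contMDiffAt_normal hU hx).mdifferentiableAt (by simp))
    ((he.contMDiffAt_frameVec hU hx j).mdifferentiableAt (by simp)) (by
      filter_upwards [hU.mem_nhds hx] with y hy
      rw [he.inner_normal_frameVec hy, he.inner_normal_frameVec hx]) v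
  exact eq_neg_of_add_eq_zero_right this

theorem inner_dvec_normal_normal (he : IsDarbouxFrame S ι U e ζ) (hU : IsOpen U) (hx : x ∈ U)
    (v : TangentSpace 𝓘(ℝ, Model m) x) :
    inner ℂ (dvec ζ x v) (ζ x) = -normalForm ζ x v := by
  have := inner_dvec_add_inner_dvec
    ((he.contMDiffAt_normal hU hx).mdifferentiableAt (by simp))
    ((he.contMDiffAt_normal hU hx).mdifferentiableAt (by simp)) (by
      filter_upwards [hU.mem_nhds hx] with y hy
      simp [inner_self_eq_norm_sq_to_K, he.unit y hy, he.unit x hx]) v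
  exact eq_neg_of_add_eq_zero_right this

theorem normalForm_re (he : IsDarbouxFrame S ι U e ζ) (hU : IsOpen U) (hx : x ∈ U)
    (v : TangentSpace 𝓘(ℝ, Model m) x) : (normalForm ζ x v).re = 0 := by
  have h1 := he.inner_dvec_normal_normal hU hx v
  have h2 : inner ℂ (dvec ζ x v) (ζ x) = (starRingEnd ℂ) (normalForm ζ x v) :=
    (inner_conj_symm _ _).symm
  rw [h2] at h1
  have := congrArg Complex.re h1
  simp only [Complex.conj_re, Complex.neg_re] at this
  linarith

theorem frameConn_skew (he : IsDarbouxFrame S ι U e ζ) (hU : IsOpen U) (hx : x ∈ U)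
    (j k : Fin m) (v : TangentSpace 𝓘(ℝ, Model m) x) :
    frameConn ι e j k x v + (starRingEnd ℂ) (frameConn ι e k j x v) = 0 := by
  have h1 := he.inner_dvec_frameVec hU hx k j v
  have h2 : inner ℂ (dvec (frameVec ι e k) x v) (frameVec ι e j x) =
    (starRingEnd ℂ) (frameConn ι e k j x v) := (inner_conj_symm _ _).symm
  rw [← h2, h1, add_neg_cancel]

variable [IsManifold 𝓘(ℝ, Model m) ∞ M]

theorem frameCoform_apply (h : IsPHSubmanifold S ι) (j : Fin m)
    (v : TangentSpace 𝓘(ℝ, Model m) x) :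
    frameCoform ι e j x v = inner ℂ (frameVec ι e j x) (dz ι x v) := by
  rw [frameCoform, connForm_apply, dvec_fst (h.mdifferentiableAt x)]

theorem inner_dz_eq (he : IsDarbouxFrame S ι U e ζ) (h : IsPHSubmanifold S ι)
    (hv : IsVertical S ι) (hx : x ∈ U) (a : EuclideanSpace ℂ (Fin (m + 1)))
    (v : TangentSpace 𝓘(ℝ, Model m) x) :
    inner ℂ a (dz ι x v) = ∑ k, inner ℂ a (frameVec ι e k x) * frameCoform ι e k x v := by
  rw [he.inner_eq hx, h.inner_normal_dz hv he.normal hx, mul_zero, add_zero]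
  simp only [frameCoform_apply h]

theorem secondCoeff_eq (he : IsDarbouxFrame S ι U e ζ) (h : IsPHSubmanifold S ι)
    (hv : IsVertical S ι) (hU : IsOpen U) (hx : x ∈ U) (j k : Fin m) :
    secondCoeff S ι e ζ x j k = mixedForm ι e ζ j x (e k x) := by
  rw [secondCoeff, h.secondForm_eq hv hU he.normal hx]
  exact neg_eq_iff_eq_neg.2 (he.inner_dvec_normal_frameVec hU hx j (e k x))

theorem secondCoeff_comm (he : IsDarbouxFrame S ι U e ζ) (h : IsPHSubmanifold S ι)
    (hv : IsVertical S ι) (hU : IsOpen U) (hx : x ∈ U) (j k : Fin m) :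
    secondCoeff S ι e ζ x j k = secondCoeff S ι e ζ x k j := by
  rw [secondCoeff, secondCoeff, h.secondForm_eq hv hU he.normal hx,
    h.secondForm_eq hv hU he.normal hx, h.inner_dvec_dz_comm hv hU he.normal hx]

/-- Symmetry exchanges v with e_j in ⟨dζ v, Z_j⟩. Then v enters through dz v only, so neither θ nor
a conjugate of the coframe can occur. -/
theorem mixedForm_eq_sum (he : IsDarbouxFrame S ι U e ζ) (h : IsPHSubmanifold S ι)
    (hv : IsVertical S ι) (hU : IsOpen U) (hx : x ∈ U) (j : Fin m)
    (v : TangentSpace 𝓘(ℝ, Model m) x) :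
    mixedForm ι e ζ j x v = ∑ k, secondCoeff S ι e ζ x j k * frameCoform ι e k x v := by
  have h1 := he.inner_dvec_normal_frameVec hU hx j v
  have h2 : inner ℂ (dvec ζ x v) (frameVec ι e j x) = inner ℂ (dvec ζ x (e j x)) (dz ι x v) :=
    h.inner_dvec_dz_comm hv hU he.normal hx v (e j x)
  rw [h2, he.inner_dz_eq h hv hx] at h1
  rw [← neg_eq_iff_eq_neg.2 h1, ← Finset.sum_neg_distrib]
  refine Finset.sum_congr rfl fun k _ => ?_
  rw [he.inner_dvec_normal_frameVec hU hx, ← he.secondCoeff_eq h hv hU hx,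
    he.secondCoeff_comm h hv hU hx]
  ring

theorem mixedForm_J (he : IsDarbouxFrame S ι U e ζ) (h : IsPHSubmanifold S ι)
    (hv : IsVertical S ι) (hU : IsOpen U) (hx : x ∈ U) (j : Fin m)
    (v : TangentSpace 𝓘(ℝ, Model m) x) :
    mixedForm ι e ζ j x (S.J x v) = Complex.I * mixedForm ι e ζ j x v := by
  rw [← neg_eq_iff_eq_neg.2 (he.inner_dvec_normal_frameVec hU hx j v),
    ← neg_eq_iff_eq_neg.2 (he.inner_dvec_normal_frameVec hU hx j (S.J x v)), mul_neg]
  exact congrArg Neg.neg (h.inner_dvec_J_dz hv hU he.normal hx v (e j x))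

theorem exists_eq_decomposition (he : IsDarbouxFrame S ι U e ζ) (h : IsPHSubmanifold S ι)
    (hv : IsVertical S ι) (hx : x ∈ U) :
    ∃ T : TangentSpace 𝓘(ℝ, Model m) x, dz ι x T = 0 ∧ S.θ x T = 1 ∧ S.J x T = 0 ∧
      ∀ v, v = S.θ x v • T + ∑ k, ((frameCoform ι e k x v).re • e k x +
        (frameCoform ι e k x v).im • S.J x (e k x)) := by
  obtain ⟨T, h1, h2, h3, -⟩ := h.exists_decomposition hv x
  refine ⟨T, h1, h2, h3, fun v => ?_⟩
  rw [← sub_eq_zero]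
  apply h.eq_zero_of_dz_eq_zero
  · have e1 : dz ι x v = ∑ k, frameCoform ι e k x v • frameVec ι e k x := by
      refine ext_inner_left ℂ fun a => ?_
      rw [he.inner_dz_eq h hv hx, inner_sum]
      refine Finset.sum_congr rfl fun k _ => ?_
      rw [inner_smul_right, mul_comm]
    rw [map_sub, map_add, map_smul, h1, smul_zero, zero_add, map_sum, e1, sub_eq_zero]
    refine Finset.sum_congr rfl fun k _ => ?_
    rw [map_add, map_smul, map_smul, h.dz_J hv]
    change _ = _ • frameVec ι e k x + _ • Complex.I • frameVec ι e k x
    conv_lhs => rw [← Complex.re_add_im (frameCoform ι e k x v)]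
    rw [add_smul, mul_smul]
    rfl
  · rw [map_sub, map_add, map_smul, h2, map_sum, Finset.sum_eq_zero]
    · simp
    · intro k _
      have hk := he.horizontal x hx k
      rw [map_add, map_smul, map_smul, hk, h.pseudohermitian.J_mem x _ hk]
      simp

/-- In d⟨dz, Z_j⟩ the normal term of Parseval's identity drops, dz being tangential. What remains is
the structure equation with torsion 0. -/
theorem isWebsterConnection (he : IsDarbouxFrame S ι U e ζ) (h : IsPHSubmanifold S ι)
    (hv : IsVertical S ι) (hU : IsOpen U) :
    IsWebsterConnection S U e (frameCoform ι e) (frameConn ι e) (fun _ _ _ => 0) where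
  smooth_η j := smoothFormOn_connForm hU (fun y _ => (h.contMDiffAt_fst y).contMDiffWithinAt)
    (he.smooth j)
  smooth_Γ j k := smoothFormOn_connForm hU (he.smooth j) (he.smooth k)
  horizontal := he.horizontal
  dual x hx j k := by
    rw [frameCoform_apply h]
    exact he.inner_frameVec hx j k
  type_one_zero x hx j v := by
    rw [frameCoform_apply h, frameCoform_apply h, h.dz_J hv, inner_smul_right]
  unitary x hx v w := by
    have e1 := he.inner_dz_eq h hv hx (dz ι x v) w
    have e2 := he.inner_dz_eq h hv hx (dz ι x w) v
    have e3 : ∀ k (v : TangentSpace 𝓘(ℝ, Model m) x), inner ℂ (dz ι x v) (frameVec ι e k x) =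
        (starRingEnd ℂ) (frameCoform ι e k x v) := fun k v => by
      rw [frameCoform_apply h, inner_conj_symm]
    simp only [e3] at e1 e2
    have e4 : ∑ j, (frameCoform ι e j x v * (starRingEnd ℂ) (frameCoform ι e j x w) -
        frameCoform ι e j x w * (starRingEnd ℂ) (frameCoform ι e j x v)) =
        inner ℂ (dz ι x w) (dz ι x v) - inner ℂ (dz ι x v) (dz ι x w) := by
      rw [e1, e2, ← Finset.sum_sub_distrib]
      exact Finset.sum_congr rfl fun k _ => by ring
    have e5 : inner ℂ (dz ι x w) (dz ι x v) = (starRingEnd ℂ) (inner ℂ (dz ι x v) (dz ι x w)) :=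
      (inner_conj_symm _ _).symm
    rw [e4, h.extD_θ, e5]
    generalize inner ℂ (dz ι x v) (dz ι x w) = c
    apply Complex.ext
    · simp; ring
    · simp
  structure_eq x hx j v w := by
    have e0 : extD (frameCoform ι e j) x v w = _ :=
      extD_connForm (h.contMDiffAt_fst x) (he.contMDiffAt_frameVec hU hx j) v w
    rw [e0, dvec_fst (h.mdifferentiableAt x), he.inner_dz_eq h hv hx, he.inner_dz_eq h hv hx,
      ← Finset.sum_sub_distrib]
    simp only [he.inner_dvec_frameVec hU hx, wedge, zero_mul, Finset.sum_const_zero, add_zero]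
    exact Finset.sum_congr rfl fun k _ => by ring
  skew x hx j k v := he.frameConn_skew hU hx j k v

/-- Duality and type fix η^j on e_k and J e_k; type also gives η^j(T) = 0, because J T = 0. -/
theorem coform_eq (he : IsDarbouxFrame S ι U e ζ) (h : IsPHSubmanifold S ι)
    (hv : IsVertical S ι) {η : Fin m → ∀ x : M, TangentSpace 𝓘(ℝ, Model m) x →L[ℝ] ℂ}
    {Γ : Fin m → Fin m → ∀ x : M, TangentSpace 𝓘(ℝ, Model m) x →L[ℝ] ℂ}
    {A : Fin m → Fin m → M → ℂ} (hW : IsWebsterConnection S U e η Γ A) (hx : x ∈ U) (j : Fin m) :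
    η j x = frameCoform ι e j x := by
  obtain ⟨T, -, -, hT, hdec⟩ := he.exists_eq_decomposition h hv hx
  ext v
  have hηT : η j x T = 0 := by
    have := hW.type_one_zero x hx j T
    rw [hT, map_zero] at this
    simpa using this.symm
  conv_lhs => rw [hdec v]
  rw [map_add, map_smul, hηT, smul_zero, zero_add, map_sum]
  simp only [map_add, map_smul, hW.type_one_zero x hx, hW.dual x hx]
  rw [Finset.sum_eq_single j]
  · simp only [if_true, mul_one, Complex.real_smul]
    exact Complex.re_add_im _
  · intro k _ hk
    simp [hk.symm]
  · simp

/-- The difference D of two Webster connections is skew-Hermitian and satisfies the structure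
equation without its exterior derivative. It is tested on the real basis T, e_k, J e_k. -/
theorem conn_eq (he : IsDarbouxFrame S ι U e ζ) (h : IsPHSubmanifold S ι)
    (hv : IsVertical S ι) (hU : IsOpen U)
    {η : Fin m → ∀ x : M, TangentSpace 𝓘(ℝ, Model m) x →L[ℝ] ℂ}
    {Γ : Fin m → Fin m → ∀ x : M, TangentSpace 𝓘(ℝ, Model m) x →L[ℝ] ℂ}
    {A : Fin m → Fin m → M → ℂ} (hW : IsWebsterConnection S U e η Γ A) (hx : x ∈ U)
    (j k : Fin m) : Γ j k x = frameConn ι e j k x := by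
  have hW0 := he.isWebsterConnection h hv hU
  obtain ⟨T, hzT, hθT, hJT, hdec⟩ := he.exists_eq_decomposition h hv hx
  have hηT : ∀ k, frameCoform ι e k x T = 0 := fun k => by
    rw [frameCoform_apply h, hzT, inner_zero_right]
  set D : Fin m → Fin m → TangentSpace 𝓘(ℝ, Model m) x →L[ℝ] ℂ :=
    fun j k => Γ j k x - frameConn ι e j k x with hD
  have hskew : ∀ j k v, D j k v + (starRingEnd ℂ) (D k j v) = 0 := fun j k v => by
    have e1 := hW.skew x hx j k v
    have e2 := hW0.skew x hx j k v
    simp only [hD, sub_apply, map_sub]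
    linear_combination e1 - e2
  have hstr : ∀ j v w, (∑ k, (frameCoform ι e k x v * D k j w - frameCoform ι e k x w * D k j v)) +
      ∑ k, A j k x * (S.θ x v * (starRingEnd ℂ) (frameCoform ι e k x w) -
        S.θ x w * (starRingEnd ℂ) (frameCoform ι e k x v)) = 0 := fun j v w => by
    have e1 := hW.structure_eq x hx j v w
    have e2 := hW0.structure_eq x hx j v w
    have e3 : extD (η j) x = extD (frameCoform ι e j) x := extD_congr (by
      filter_upwards [hU.mem_nhds hx] with y hy using he.coform_eq h hv hW hy j)
    rw [e3, e2] at e1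
    simp only [he.coform_eq h hv hW hx, wedge, zero_mul, Finset.sum_const_zero, add_zero] at e1
    have e4 : ∑ k, (frameCoform ι e k x v * D k j w - frameCoform ι e k x w * D k j v) =
        ∑ k, (frameCoform ι e k x v * Γ k j x w - frameCoform ι e k x w * Γ k j x v) -
        ∑ k, (frameCoform ι e k x v * frameConn ι e k j x w -
          frameCoform ι e k x w * frameConn ι e k j x v) := by
      rw [← Finset.sum_sub_distrib]
      refine Finset.sum_congr rfl fun k _ => ?_
      simp only [hD, sub_apply]
      ring
    rw [e4]
    linear_combination -e1
  have hJe : ∀ p, S.θ x (S.J x (e p x)) = 0 := fun p =>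
    h.pseudohermitian.J_mem x _ (he.horizontal x hx p)
  -- The pairs (e_p, T) and (J e_p, T) give D_p^j(T) = A_{jp} and D_p^j(T) = -A_{jp}, as the torsion
  -- form is of type (0,1).
  have hDT : ∀ p j, D p j T = 0 := fun p j => by
    have e1 := hstr j (e p x) T
    have e2 := hstr j (S.J x (e p x)) T
    simp only [hW0.type_one_zero x hx] at e2
    simp [hηT, hθT, he.horizontal x hx, hW0.dual x hx, hJe, apply_ite (starRingEnd ℂ)] at e1 e2
    have e3 : Complex.I * (2 * D p j T) = 0 := by
      linear_combination e2 + Complex.I * e1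
    simpa using e3
  -- On contact vectors the structure equation makes D complex linear with respect to J, while the
  -- skew symmetry makes it antilinear.
  have hDe : ∀ q j p, D q j (e p x) = 0 ∧ D q j (S.J x (e p x)) = 0 := fun q j p => by
    have key : ∀ q j p, D q j (S.J x (e p x)) = Complex.I * D q j (e p x) := fun q j p => by
      have e1 := hstr j (e p x) (e q x)
      have e2 := hstr j (S.J x (e p x)) (e q x)
      simp only [hW0.type_one_zero x hx] at e2
      simp [he.horizontal x hx, hW0.dual x hx, hJe, Finset.sum_sub_distrib] at e1 e2
      linear_combination Complex.I * e1 - e2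
    have e1 := hskew q j (S.J x (e p x))
    have e2 := hskew q j (e p x)
    rw [key, key, map_mul, Complex.conj_I] at e1
    have e3 : Complex.I * (2 * D q j (e p x)) = 0 := by
      linear_combination e1 + Complex.I * e2
    have e4 : D q j (e p x) = 0 := by simpa using e3
    exact ⟨e4, by rw [key, e4, mul_zero]⟩
  have : D j k = 0 := by
    ext v
    rw [hdec v, map_add, map_smul, hDT, smul_zero, zero_add, map_sum]
    simp [hDe]
  exact sub_eq_zero.1 this

/-- Parseval's identity splits the products of dZ_l with dZ_j: the tangential part is Γ ∧ Γ, so the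
normal part is the curvature. -/
theorem extD_frameConn (he : IsDarbouxFrame S ι U e ζ) (hU : IsOpen U) (hx : x ∈ U)
    (j l : Fin m) (v w : TangentSpace 𝓘(ℝ, Model m) x) :
    extD (frameConn ι e j l) x v w =
      (∑ k, wedge (frameConn ι e j k x) (frameConn ι e k l x) v w) +
        ((starRingEnd ℂ) (mixedForm ι e ζ l x v) * mixedForm ι e ζ j x w -
          (starRingEnd ℂ) (mixedForm ι e ζ l x w) * mixedForm ι e ζ j x v) := by
  have e0 : extD (frameConn ι e j l) x v w = _ :=
    extD_connForm (he.contMDiffAt_frameVec hU hx j) (he.contMDiffAt_frameVec hU hx l) v w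
  rw [e0, he.inner_eq hx (dvec (frameVec ι e l) x v), he.inner_eq hx (dvec (frameVec ι e l) x w)]
  simp only [he.inner_dvec_frameVec hU hx, inner_dvec_frameVec_normal, wedge]
  rw [Finset.sum_sub_distrib]
  change ∑ k, -frameConn ι e k l x v * frameConn ι e j k x w + _ * mixedForm ι e ζ j x w -
    (∑ k, -frameConn ι e k l x w * frameConn ι e j k x v + _ * mixedForm ι e ζ j x v) = _
  simp only [neg_mul, Finset.sum_neg_distrib, mul_comm (frameConn ι e _ l x _)]
  ring

/-- The Gauss-like equation. -/
theorem websterCurvature_eq (he : IsDarbouxFrame S ι U e ζ) (h : IsPHSubmanifold S ι)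
    (hv : IsVertical S ι) (hU : IsOpen U) (hx : x ∈ U) (j l p q : Fin m) :
    websterCurvature S e (frameConn ι e) x j l p q =
      -(secondCoeff S ι e ζ x j p * (starRingEnd ℂ) (secondCoeff S ι e ζ x l q)) := by
  -- Since the θ_j^n are of type (1,0), the four evaluations cancel in the first product of the
  -- normal part and add up, against the factor 1/4, in the second.
  simp only [websterCurvature, he.extD_frameConn hU hx, add_sub_cancel_left,
    he.mixedForm_J h hv hU hx, he.secondCoeff_eq h hv hU hx, map_mul, Complex.conj_I]
  ring_nf
  simp only [Complex.I_sq]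
  ring

/-- The Codazzi-like equation. -/
theorem extD_mixedForm (he : IsDarbouxFrame S ι U e ζ) (hU : IsOpen U) (hx : x ∈ U)
    (j : Fin m) (v w : TangentSpace 𝓘(ℝ, Model m) x) :
    extD (mixedForm ι e ζ j) x v w =
      (∑ k, wedge (frameConn ι e j k x) (mixedForm ι e ζ k x) v w) +
        wedge (mixedForm ι e ζ j x) (normalForm ζ x) v w := by
  have e0 : extD (mixedForm ι e ζ j) x v w = _ :=
    extD_connForm (he.contMDiffAt_frameVec hU hx j) (he.contMDiffAt_normal hU hx) v w
  rw [e0, he.inner_eq hx (dvec ζ x v), he.inner_eq hx (dvec ζ x w)]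
  simp only [he.inner_dvec_normal_frameVec hU hx, he.inner_dvec_normal_normal hU hx, wedge]
  rw [Finset.sum_sub_distrib]
  change ∑ k, -mixedForm ι e ζ k x v * frameConn ι e j k x w + _ * mixedForm ι e ζ j x w -
    (∑ k, -mixedForm ι e ζ k x w * frameConn ι e j k x v + _ * mixedForm ι e ζ j x v) = _
  simp only [neg_mul, Finset.sum_neg_distrib, mul_comm (mixedForm ι e ζ _ x _)]
  ring

/-- If all h_{jk} vanished, ζ would be orthogonal to the first and second derivatives of z, which
span at this point. -/
theorem exists_secondCoeff_ne_zero (he : IsDarbouxFrame S ι U e ζ) (h : IsPHSubmanifold S ι)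
    (hv : IsVertical S ι) (hU : IsOpen U) (hx : x ∈ U) (hf : ¬ IsFlatPoint S ι x) :
    ∃ j k, secondCoeff S ι e ζ x j k ≠ 0 := by
  by_contra! hcon
  have hmix : ∀ j v, mixedForm ι e ζ j x v = 0 := fun j v => by
    rw [he.mixedForm_eq_sum h hv hU hx]
    simp [hcon]
  have hζ : ζ x = 0 := by
    refine eq_zero_of_forall_inner_eq_zero (h.span_jetFamily hv hf) ?_
    rintro (v | ⟨u, v⟩)
    · rw [jetFamily, Sum.elim_inl, fderiv_comp_extChartAt_symm_self
        ((h.contMDiffAt_fst _).mdifferentiableAt (by simp)), ← h.dz_eq]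
      exact h.inner_normal_dz hv he.normal hx v
    · have hdz : ∀ u v : TangentSpace 𝓘(ℝ, Model m) x, -inner ℂ (dvec ζ x u) (dz ι x v) = 0 :=
        fun u v => by
          rw [he.inner_dz_eq h hv hx]
          simp [he.inner_dvec_normal_frameVec hU hx, hmix]
      exact (h.inner_normal_fderiv2 hv hU he.normal hx u v).trans (hdz u v)
  have := he.unit x hx
  rw [hζ, norm_zero] at this
  exact zero_ne_one this

/-- The Codazzi-like equation determines the normal connection. -/
theorem eq_normalForm (he : IsDarbouxFrame S ι U e ζ) (h : IsPHSubmanifold S ι)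
    (hv : IsVertical S ι) (hU : IsOpen U) (hx : x ∈ U) (hf : ¬ IsFlatPoint S ι x)
    {α : TangentSpace 𝓘(ℝ, Model m) x →L[ℝ] ℂ} (hα : ∀ v, (α v).re = 0)
    (hC : ∀ j v w, extD (mixedForm ι e ζ j) x v w =
      (∑ k, wedge (frameConn ι e j k x) (mixedForm ι e ζ k x) v w) +
        wedge (mixedForm ι e ζ j x) α v w) : α = normalForm ζ x := by
  obtain ⟨j, k, hjk⟩ := he.exists_secondCoeff_ne_zero h hv hU hx hf
  rw [he.secondCoeff_eq h hv hU hx] at hjk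
  set β := α - normalForm ζ x with hβ
  have hβre : ∀ v, (β v).re = 0 := fun v => by
    simp [hβ, hα, he.normalForm_re hU hx]
  -- Subtracting the two Codazzi equations gives θ_j^n ∧ β = 0, evaluated here on (e_k, w) with
  -- θ_j^n(e_k) = h_{jk} ≠ 0.
  have hw : ∀ w, mixedForm ι e ζ j x (e k x) * β w =
      mixedForm ι e ζ j x w * β (e k x) := fun w => by
    have e1 := hC j (e k x) w
    rw [he.extD_mixedForm hU hx, add_right_inj] at e1
    simp only [wedge] at e1
    simp only [hβ, sub_apply]
    linear_combination -e1
  -- As θ_j^n is of type (1,0), β(J e_k) = i β(e_k). Both values of β are imaginary, hence zero.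
  have h1 := hw (S.J x (e k x))
  rw [he.mixedForm_J h hv hU hx, mul_comm Complex.I, mul_assoc] at h1
  have h2 := mul_left_cancel₀ hjk h1
  have h3 : β (e k x) = 0 := by
    refine Complex.ext (hβre _) ?_
    have := congrArg Complex.re h2
    simpa [hβre] using this
  have : β = 0 := by
    ext w
    have := hw w
    rw [h3, mul_zero] at this
    exact (mul_eq_zero.1 this).resolve_left hjk
  exact sub_eq_zero.1 this

end IsDarbouxFrame

/-- A nonzero matrix is determined up to phase by the products `h_{jp} conj h_{lq}`. -/
theorem exists_phase_of_mul_conj_eq {ι₁ ι₂ : Type*} {h k : ι₁ → ι₂ → ℂ} (h0 : ∃ j l, h j l ≠ 0)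
    (hk : ∀ j l p q, k j p * (starRingEnd ℂ) (k l q) = h j p * (starRingEnd ℂ) (h l q)) :
    ∃ u : ℂ, ‖u‖ = 1 ∧ ∀ j l, k j l = u * h j l := by
  obtain ⟨l, q, hlq⟩ := h0
  have hnorm : ‖k l q‖ = ‖h l q‖ := by
    have := hk l l q q
    rw [Complex.mul_conj, Complex.mul_conj, Complex.ofReal_inj, Complex.normSq_eq_norm_sq,
      Complex.normSq_eq_norm_sq] at this
    exact (sq_eq_sq₀ (norm_nonneg _) (norm_nonneg _)).1 this
  have hklq : (starRingEnd ℂ) (k l q) ≠ 0 := by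
    rw [map_ne_zero, ← norm_ne_zero_iff, hnorm, norm_ne_zero_iff]
    exact hlq
  -- The phase comes from k_{jp} conj k_{lq} = h_{jp} conj h_{lq} with (l, q) fixed at a nonzero
  -- entry.
  refine ⟨(starRingEnd ℂ) (h l q) / (starRingEnd ℂ) (k l q), ?_, fun j p => ?_⟩
  · rw [norm_div, RCLike.norm_conj, RCLike.norm_conj, hnorm, div_self]
    exact norm_ne_zero_iff.2 hlq
  · rw [div_mul_eq_mul_div, eq_div_iff hklq, hk]
    ring

end Darboux

end Pseudohermitian

end

theorem theoremC (m : ℕ) (hm : 1 ≤ m)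
    {M : Type*} [TopologicalSpace M] [ChartedSpace (Model m) M] [IsManifold 𝓘(ℝ, Model m) ∞ M]
    [SimplyConnectedSpace M]
    {N : Type*} [TopologicalSpace N] [ChartedSpace (Model m) N] [IsManifold 𝓘(ℝ, Model m) ∞ N]
    [SimplyConnectedSpace N]
    (SM : PHData (Model m) M) (ιM : M → Heis (m + 1)) (hM : IsPHSubmanifold SM ιM)
    (hMv : IsVertical SM ιM) (hMf : ∀ x, ¬ IsFlatPoint SM ιM x)
    (SN : PHData (Model m) N) (ιN : N → Heis (m + 1)) (hN : IsPHSubmanifold SN ιN)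
    (hNv : IsVertical SN ιN) (hNf : ∀ y, ¬ IsFlatPoint SN ιN y) :
    -- a diffeomorphism is a pseudohermitian transformation iff it is the restriction of a
    -- Heisenberg rigid motion
    (∀ φ : M ≃ₘ^∞⟮𝓘(ℝ, Model m), 𝓘(ℝ, Model m)⟯ N,
      IsPHTransformation SM SN φ ↔
        ∃ Φ : Heis (m + 1) ≃ₘ^∞⟮𝓘(ℝ, Heis (m + 1)), 𝓘(ℝ, Heis (m + 1))⟯ Heis (m + 1),
          IsRigidMotion Φ ∧ ∀ x, ιN (φ x) = Φ (ιM x)) ∧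
    -- the Gauss-like and Codazzi-like equations, and what they determine
    (∀ (U : Set M) (e : Fin m → ∀ x : M, TangentSpace 𝓘(ℝ, Model m) x)
      (ζ : M → EuclideanSpace ℂ (Fin (m + 1))), IsOpen U → IsDarbouxFrame SM ιM U e ζ →
      (∃ η Γ A, IsWebsterConnection SM U e η Γ A) ∧
      ∀ η Γ A, IsWebsterConnection SM U e η Γ A → ∀ x ∈ U,
        -- `II` is symmetric and `θ_j^n = ∑ h_{jk} θ^k`
        (∀ j k, secondCoeff SM ιM e ζ x j k = secondCoeff SM ιM e ζ x k j) ∧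
        (∀ j v, mixedForm ιM e ζ j x v = ∑ k, secondCoeff SM ιM e ζ x j k * η k x v) ∧
        -- the Gauss-like equation
        (∀ j l p q, websterCurvature SM e Γ x j l p q =
          -(secondCoeff SM ιM e ζ x j p * (starRingEnd ℂ) (secondCoeff SM ιM e ζ x l q))) ∧
        -- it determines `II` up to the choice of the unit normal
        (∀ k : Fin m → Fin m → ℂ,
          (∀ j l p q, websterCurvature SM e Γ x j l p q =
            -(k j p * (starRingEnd ℂ) (k l q))) →
          ∃ u : ℂ, ‖u‖ = 1 ∧ ∀ j l, k j l = u * secondCoeff SM ιM e ζ x j l) ∧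
        -- the Codazzi-like equation
        (∀ j v w, extD (mixedForm ιM e ζ j) x v w =
          (∑ k, wedge (Γ j k x) (mixedForm ιM e ζ k x) v w) +
            wedge (mixedForm ιM e ζ j x) (normalForm ζ x) v w) ∧
        -- it determines the normal connection
        (∀ α : TangentSpace 𝓘(ℝ, Model m) x →L[ℝ] ℂ, (∀ v, (α v).re = 0) →
          (∀ j v w, extD (mixedForm ιM e ζ j) x v w =
            (∑ k, wedge (Γ j k x) (mixedForm ιM e ζ k x) v w) +
              wedge (mixedForm ιM e ζ j x) α v w) →
          α = normalForm ζ x)) ∧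
    -- hence `II` and the normal connection are invariants of the induced structure
    (∀ φ : M ≃ₘ^∞⟮𝓘(ℝ, Model m), 𝓘(ℝ, Model m)⟯ N, IsPHTransformation SM SN φ →
      ∀ (U : Set M) (e : Fin m → ∀ x : M, TangentSpace 𝓘(ℝ, Model m) x)
        (ζ : M → EuclideanSpace ℂ (Fin (m + 1))), IsOpen U → IsDarbouxFrame SM ιM U e ζ →
      ∃ (e' : Fin m → ∀ y : N, TangentSpace 𝓘(ℝ, Model m) y)
        (ζ' : N → EuclideanSpace ℂ (Fin (m + 1))), IsDarbouxFrame SN ιN (φ '' U) e' ζ' ∧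
        (∀ x ∈ U, ∀ j,
          e' j (φ x) = mfderiv 𝓘(ℝ, Model m) 𝓘(ℝ, Model m) φ x (e j x)) ∧
        (∀ x ∈ U, ∀ j k, secondCoeff SN ιN e' ζ' (φ x) j k = secondCoeff SM ιM e ζ x j k) ∧
        (∀ x ∈ U, ∀ v,
          normalForm ζ' (φ x) (mfderiv 𝓘(ℝ, Model m) 𝓘(ℝ, Model m) φ x v) =
            normalForm ζ x v)) := by
  -- Pulled back by φ, the immersion of N becomes a second vertical immersion of M inducing the same
  -- structure.
  have key : ∀ φ : M ≃ₘ^∞⟮𝓘(ℝ, Model m), 𝓘(ℝ, Model m)⟯ N, IsPHTransformation SM SN φ →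
      ∃ (V : EuclideanSpace ℂ (Fin (m + 1)) ≃ₗᵢ[ℂ] EuclideanSpace ℂ (Fin (m + 1)))
        (b : EuclideanSpace ℂ (Fin (m + 1))) (c : ℝ), ∀ x, ιN (φ x) = heisMap V b c (ιM x) :=
    fun φ hφ => hM.exists_congruence hMv hMf (hN.comp_diffeomorph hM.pseudohermitian hφ)
      (IsVertical.comp_diffeomorph hN hNv)
  refine ⟨fun φ => ⟨fun hφ => ?_, fun ⟨Φ, hΦ, h⟩ =>
    isPHTransformation_of_isRigidMotion hM hN hΦ h⟩, fun U e ζ hU he => ?_,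
    fun φ hφ U e ζ hU he => ?_⟩
  · obtain ⟨V, b, c, h⟩ := key φ hφ
    exact ⟨heisMap V b c, isRigidMotion_heisMap V b c, h⟩
  · refine ⟨⟨_, _, _, he.isWebsterConnection hM hMv hU⟩, fun η Γ A hW x hx => ?_⟩
    -- The equality is needed on all of U, because the curvature differentiates Γ.
    have hΓ : ∀ y ∈ U, ∀ j k, Γ j k y = frameConn ιM e j k y := fun y hy j k =>
      he.conn_eq hM hMv hU hW hy j k
    have hR : ∀ j l p q, websterCurvature SM e Γ x j l p q =
        -(secondCoeff SM ιM e ζ x j p * (starRingEnd ℂ) (secondCoeff SM ιM e ζ x l q)) :=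
      fun j l p q => by
        rw [IsDarbouxFrame.websterCurvature_congr hU hΓ hx, he.websterCurvature_eq hM hMv hU hx]
    refine ⟨he.secondCoeff_comm hM hMv hU hx, fun j v => ?_, hR, fun k hk => ?_,
      fun j v w => ?_, fun α hα hC => ?_⟩
    · simp only [he.coform_eq hM hMv hW hx]
      exact he.mixedForm_eq_sum hM hMv hU hx j v
    · refine exists_phase_of_mul_conj_eq
        (he.exists_secondCoeff_ne_zero hM hMv hU hx (hMf x)) fun j l p q => ?_
      exact neg_injective ((hk j l p q).symm.trans (hR j l p q))
    · simp only [hΓ x hx]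
      exact he.extD_mixedForm hU hx j v w
    · simp only [hΓ x hx] at hC
      exact he.eq_normalForm hM hMv hU hx (hMf x) hα hC
  · obtain ⟨V, b, c, h⟩ := key φ hφ
    exact exists_transported_frame hN hM hφ h hU he
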